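/- Let $0<a\le 1$, $\theta>0$ and $c\in\mathbb R$, and assume that $c\ge 0$, or that $a=1$ and $c>-\theta$. Write $E_{a,b}(z)=\sum_{k\ge 0} z^k/\Gamma(ak+b)$ for the two-parameter Mittag-Leffler function and $E_a=E_{a,1}$. Then $$F(x)=\bigl(1-e^{-\theta x}E_a(-cx^a)\bigr)\mathbf 1_{\{x\ge 0\}},\qquad x\in\mathbb R,$$ is the cumulative distribution function of a probability law on $[0,\infty)$, the tempered Mittag-Leffler law $\mathrm{TML}(a,c,\theta)$. This law is absolutely continuous with density $$f(x)=e^{-\theta x}\bigl(\theta E_a(-cx^a)+c\,x^{a-1}E_{a,a}(-cx^a)\bigr)\mathbf 1_{\{x\ge 0\}}$$ (the value at $x=0$ being irrelevant), and if $U$ has this law, its Laplace transform is $$\mathbb E\,e^{-sU}=\frac{\theta(s+\theta)^{a-1}+c}{(s+\theta)^a+c},\qquad s\in\mathbb C,\ \operatorname{Re}(s)>0,$$ with principal branches of the powers. Moreover, $U$ is infinitely divisible: for every integer $n\ge 1$, $U$ is equal in distribution to a sum of $n$ i.i.d. random variables. -/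

import Mathlib

open MeasureTheory

noncomputable section

/-- The two-parameter Mittag-Leffler function `E_{a,b}(z) = ∑_{k ≥ 0} z ^ k / Γ(a k + b)`
at a real argument `z`; the series converges for all `z` when `a, b > 0`. -/
def mittagLeffler₂ (a b z : ℝ) : ℝ :=
  ∑' k : ℕ, z ^ k / Real.Gamma (a * k + b)

/-- The one-parameter Mittag-Leffler function `E_a = E_{a,1}`. -/
def mittagLeffler (a z : ℝ) : ℝ :=
  mittagLeffler₂ a 1 z

/-- `F(x) = (1 - e^{-θ x} E_a(-c x ^ a)) 1_{x ≥ 0}`. -/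
def tmlCDF (a c θ x : ℝ) : ℝ :=
  if 0 ≤ x then 1 - Real.exp (-θ * x) * mittagLeffler a (-c * x ^ a) else 0

/-- `f(x) = e^{-θ x} (θ E_a(-c x ^ a) + c x ^ (a - 1) E_{a,a}(-c x ^ a)) 1_{x ≥ 0}`. -/
def tmlPDF (a c θ x : ℝ) : ℝ :=
  if 0 ≤ x then
    Real.exp (-θ * x) *
      (θ * mittagLeffler a (-c * x ^ a)
        + c * x ^ (a - 1) * mittagLeffler₂ a a (-c * x ^ a))
  else 0

/-- A law `μ` on `ℝ` is infinitely divisible: for every `n ≥ 1` there is a probability law `ν`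
such that the sum of `n` independent random variables with law `ν` (realized as the coordinates
on the `n`-fold product space) has law `μ`. -/
def IsInfinitelyDivisible (μ : Measure ℝ) : Prop :=
  ∀ n : ℕ, 1 ≤ n → ∃ ν : Measure ℝ, IsProbabilityMeasure ν ∧
    (Measure.pi (fun _ : Fin n => ν)).map (fun x : Fin n → ℝ => ∑ i, x i) = μ

end

/-! The law is built from its Laplace transform, and the formulas for `f` and `F` are identified
afterwards; positivity of `f` is an output, not an input.

Put `z = s + θ = e ^ w` and let `φ(z) = (θ z ^ (a - 1) + c) / (z ^ a + c)`. When `a < 1` and `c >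
0`, `φ` is analytic up to both sides of the negative axis, avoids the cut of the principal powers,
and has negative imaginary part for `0 < arg z ≤ π` (`tmlSymbol_im_neg`). Every power `φ ^ p` with
`0 < p ≤ 1` keeps that sign, so Cauchy's formula on the slit plane (`integral_stripJump`) gives
`φ(z) ^ p = ∫ ρ(v) e ^ v / (e ^ v + z) dv` with `ρ ≥ 0` (`exists_stieltjes_density`). As `1 / (e ^ v
+ θ + s)` is the transform of `e ^ (-(e ^ v + θ) x)`, `φ(s + θ) ^ p` is the transform of a mixture
of exponentials (`exists_exponential_mixture`), of mass one because `φ(θ) = 1`. Taking `p = 1 / n`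
produces convolution roots, and `n = 1` the law itself. If `a = 1` or `c = 0` the law is exponential
with gamma roots (`exists_tml_root_of_exponential`).

Integrating the Mittag-Leffler series term by term shows that `f` has the same transform, but only
for large `Re s` (`laplace_tmlPDF`). One vertical line suffices for uniqueness, even with the sign
of `f` unknown (`eq_withDensity_of_laplace_eq`). Differentiating `F` gives `f`, hence the
distribution function. -/

noncomputable section

open Set Filter Topology

/-! ### Convergence, continuity and derivative of Mittag-Leffler series. -/

section MittagLeffler

/-- Only the part of Euler's integral over `(M, M + 1]` is kept. Since `M` is free, `Γ` outgrows
every geometric sequence, which is what the convergence of the series needs. -/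
theorem Real.exp_mul_rpow_le_Gamma {M y : ℝ} (hM : 1 ≤ M) (hy : 1 ≤ y) :
    Real.exp (-(M + 1)) * M ^ (y - 1) ≤ Real.Gamma y := by
  rw [Real.Gamma_eq_integral (by linarith)]
  have hint : IntegrableOn (fun x : ℝ => Real.exp (-x) * x ^ (y - 1)) (Ioi 0) :=
    Real.GammaIntegral_convergent (by linarith)
  have hsub : Ioc M (M + 1) ⊆ Ioi 0 := fun x hx => by
    have := hx.1; simp only [mem_Ioi]; linarith
  calc Real.exp (-(M + 1)) * M ^ (y - 1)
      = ∫ _ in Ioc M (M + 1), Real.exp (-(M + 1)) * M ^ (y - 1) := by simp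
    _ ≤ ∫ x in Ioc M (M + 1), Real.exp (-x) * x ^ (y - 1) := by
        refine setIntegral_mono_on (integrableOn_const (by simp)) (hint.mono_set hsub) measurableSet_Ioc
          fun x hx => ?_
        refine mul_le_mul (Real.exp_le_exp.2 (by linarith [hx.2]))
          (Real.rpow_le_rpow (by linarith) hx.1.le (by linarith)) (by positivity) (by positivity)
    _ ≤ _ := setIntegral_mono_set hint
        ((ae_restrict_iff' measurableSet_Ioi).2 (ae_of_all _ fun x hx => by
          have : (0 : ℝ) < x := hx
          positivity)) (ae_of_all _ hsub)

theorem summable_pow_div_Gamma {a b : ℝ} (ha : 0 < a) (z : ℝ) :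
    Summable fun k : ℕ => z ^ k / Real.Gamma (a * k + b) := by
  -- Chosen so that `M ^ a = 2|z| + 1`, which makes the comparison ratio `|z| / M ^ a` less than
  -- one.
  set M : ℝ := (2 * |z| + 1) ^ (1 / a) with hMdef
  have hz := abs_nonneg z
  have hM : 1 ≤ M := Real.one_le_rpow (by linarith) (by positivity)
  have hM0 : 0 < M := by linarith
  have hMa : M ^ a = 2 * |z| + 1 := by
    rw [hMdef, ← Real.rpow_mul (by linarith), one_div_mul_cancel ha.ne', Real.rpow_one]
  have hr : |z| / M ^ a < 1 := by
    rw [hMa, div_lt_one (by linarith)]; linarith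
  have hs : Summable fun k : ℕ => Real.exp (M + 1) * M ^ (1 - b) * (|z| / M ^ a) ^ k :=
    (summable_geometric_of_lt_one (by positivity) hr).mul_left _
  refine hs.of_norm_bounded_eventually_nat ?_
  have htend : Tendsto (fun k : ℕ => a * (k : ℝ) + b) atTop atTop :=
    tendsto_atTop_add_const_right _ _ (tendsto_natCast_atTop_atTop.const_mul_atTop ha)
  filter_upwards [htend.eventually_ge_atTop 1] with k hk
  have hG := Real.exp_mul_rpow_le_Gamma hM hk
  have hpos : 0 < Real.exp (-(M + 1)) * M ^ (a * (k : ℝ) + b - 1) := by positivity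
  rw [norm_div, norm_pow, Real.norm_eq_abs, Real.norm_of_nonneg (hpos.le.trans hG)]
  calc |z| ^ k / Real.Gamma (a * k + b)
      ≤ |z| ^ k / (Real.exp (-(M + 1)) * M ^ (a * (k : ℝ) + b - 1)) := by gcongr
    _ = _ := by
      have h1 : M ^ (a * (k : ℝ) + b - 1) = (M ^ a) ^ k * (M ^ (1 - b))⁻¹ := by
        rw [← Real.rpow_neg hM0.le, ← Real.rpow_natCast, ← Real.rpow_mul hM0.le,
          ← Real.rpow_add hM0]
        ring_nf
      rw [h1, Real.exp_neg, div_pow]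
      field_simp

theorem Gamma_mul_natCast_add_pos {a b : ℝ} (ha : 0 < a) (hb : 0 < b) (k : ℕ) :
    0 < Real.Gamma (a * k + b) :=
  Real.Gamma_pos_of_pos (by positivity)

theorem hasSum_mittagLeffler₂ {a : ℝ} (b : ℝ) (ha : 0 < a) (z : ℝ) :
    HasSum (fun k : ℕ => z ^ k / Real.Gamma (a * k + b)) (mittagLeffler₂ a b z) :=
  (summable_pow_div_Gamma ha z).hasSum

theorem continuous_mittagLeffler₂ {a b : ℝ} (ha : 0 < a) (hb : 0 < b) :
    Continuous (mittagLeffler₂ a b) := by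
  rw [continuous_iff_continuousAt]
  intro z
  have hmem : Metric.ball (0 : ℝ) (|z| + 1) ∈ 𝓝 z :=
    Metric.isOpen_ball.mem_nhds (by simp)
  refine ContinuousOn.continuousAt ?_ hmem
  refine continuousOn_tsum (fun k => by fun_prop)
    (summable_pow_div_Gamma (a := a) (b := b) ha (|z| + 1)) fun k y hy => ?_
  have := Gamma_mul_natCast_add_pos ha hb k
  rw [norm_div, norm_pow, Real.norm_of_nonneg this.le]
  have : ‖y‖ ≤ |z| + 1 := by simpa using (mem_ball_zero_iff.1 hy).le
  gcongr

/-- `Γ(x + 1) = x Γ(x)` at `x = a(k + 1)` absorbs the factor `k + 1` from differentiation; this is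
how `E_{a,a} / a` arises as the derivative of `E_a`. -/
theorem natCast_mul_pow_div_Gamma {a : ℝ} (ha : 0 < a) (z : ℝ) (k : ℕ) :
    ((k + 1 : ℕ) : ℝ) * z ^ k / Real.Gamma (a * (k + 1 : ℕ) + 1)
      = z ^ k / Real.Gamma (a * k + a) / a := by
  have hx : a * ((k + 1 : ℕ) : ℝ) ≠ 0 := by positivity
  have hG := Gamma_mul_natCast_add_pos ha ha k
  have hk : a * (k : ℝ) + a = a * ((k + 1 : ℕ) : ℝ) := by push_cast; ring
  rw [hk] at hG ⊢
  rw [Real.Gamma_add_one hx]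
  field_simp

theorem hasDerivAt_mittagLeffler {a : ℝ} (ha : 0 < a) (z : ℝ) :
    HasDerivAt (mittagLeffler a) (mittagLeffler₂ a a z / a) z := by
  set R := |z| + 1
  have hsum : Summable fun k : ℕ => (k : ℝ) * R ^ (k - 1) / Real.Gamma (a * k + 1) := by
    rw [← summable_nat_add_iff 1]
    simp only [Nat.add_sub_cancel, natCast_mul_pow_div_Gamma ha]
    exact (summable_pow_div_Gamma ha R).div_const a
  have h := hasDerivAt_tsum_of_isPreconnected (𝕜 := ℝ) (F := ℝ)
    (g := fun (k : ℕ) z => z ^ k / Real.Gamma (a * k + 1))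
    (g' := fun (k : ℕ) z => (k : ℝ) * z ^ (k - 1) / Real.Gamma (a * k + 1))
    (t := Metric.ball (0 : ℝ) R) (y₀ := z) (y := z) hsum Metric.isOpen_ball
    (convex_ball 0 R).isPreconnected
    (fun k y _ => (hasDerivAt_pow k y).div_const _)
    (fun k y hy => by
      have := Gamma_mul_natCast_add_pos ha one_pos k
      rw [norm_div, norm_mul, norm_pow, Real.norm_of_nonneg this.le, Real.norm_natCast]
      have : ‖y‖ ≤ R := (mem_ball_zero_iff.1 hy).le
      gcongr)
    (by simp [R]) (summable_pow_div_Gamma ha z) (by simp [R])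
  convert! h using 1
  have hs : Summable fun k : ℕ => (k : ℝ) * z ^ (k - 1) / Real.Gamma (a * k + 1) := by
    rw [← summable_nat_add_iff 1]
    simp only [Nat.add_sub_cancel, natCast_mul_pow_div_Gamma ha]
    exact (summable_pow_div_Gamma ha z).div_const a
  rw [hs.tsum_eq_zero_add]
  simp only [Nat.add_sub_cancel, natCast_mul_pow_div_Gamma ha]
  simp [mittagLeffler₂, tsum_div_const]

theorem mittagLeffler_zero (a : ℝ) : mittagLeffler a 0 = 1 := by
  rw [mittagLeffler, mittagLeffler₂, tsum_eq_single 0]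
  · simp
  · intro k hk; simp [hk]

end MittagLeffler

/-! ### Euler's Gamma integral with a complex rate. -/

section Laplace

theorem integrableOn_rpow_mul_exp_neg_mul {y r : ℝ} (hy : 0 < y) (hr : 0 < r) :
    IntegrableOn (fun x : ℝ => x ^ (y - 1) * Real.exp (-(r * x))) (Ioi 0) := by
  have := integrableOn_rpow_mul_exp_neg_mul_rpow (p := 1) (s := y - 1) (b := r) (by linarith)
    one_pos hr
  simpa using this

/-- The real-rate formula is continued analytically: the integral is the complex moment generating
function of `x ^ (y - 1) dx`, hence analytic on a half-plane, and the identity theorem applies. -/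
theorem integral_rpow_mul_cexp_neg_mul_Ioi {y : ℝ} {s : ℂ} (hy : 0 < y) (hs : 0 < s.re) :
    ∫ x : ℝ in Ioi 0, ((x ^ (y - 1) : ℝ) : ℂ) * Complex.exp (-s * x)
      = s ^ (-y : ℂ) * Real.Gamma y := by
  set d : ℝ → NNReal := fun x => (x ^ (y - 1)).toNNReal with hd
  have hdm : Measurable d := by fun_prop
  set μ : Measure ℝ := (volume.restrict (Ioi 0)).withDensity (fun x => (d x : ENNReal)) with hμ
  have hcongr : ∀ {E : Type} [NormedAddCommGroup E] [NormedSpace ℝ E] (v : E),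
      ∀ x ∈ Ioi (0 : ℝ), d x • v = x ^ (y - 1) • v := by
    intro E _ _ v x hx
    have : (0 : ℝ) ≤ x ^ (y - 1) := Real.rpow_nonneg (le_of_lt hx) _
    rw [NNReal.smul_def, hd]
    simp [Real.coe_toNNReal _ this]
  have hint : ∀ t : ℝ, t < 0 → t ∈ ProbabilityTheory.integrableExpSet id μ := by
    intro t ht
    have h := integrableOn_rpow_mul_exp_neg_mul hy (neg_pos.2 ht)
    change Integrable _ _
    rw [hμ, integrable_withDensity_iff_integrable_smul hdm]
    refine h.congr_fun (fun x hx => ?_) measurableSet_Ioi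
    rw [hcongr _ x hx]
    simp
  have hcm : ∀ z : ℂ, ProbabilityTheory.complexMGF id μ z
      = ∫ x : ℝ in Ioi 0, ((x ^ (y - 1) : ℝ) : ℂ) * Complex.exp (z * x) := by
    intro z
    rw [ProbabilityTheory.complexMGF, hμ, integral_withDensity_eq_integral_smul hdm]
    refine setIntegral_congr_fun measurableSet_Ioi fun x hx => ?_
    rw [hcongr _ x hx]
    simp
  have hU : IsOpen {z : ℂ | z.re < 0} := isOpen_lt Complex.continuous_re continuous_const
  have hf : AnalyticOnNhd ℂ (ProbabilityTheory.complexMGF id μ) {z | z.re < 0} := by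
    refine ProbabilityTheory.analyticOnNhd_complexMGF.mono fun z hz => ?_
    exact interior_mono (s := Iio 0) (fun t ht => hint t ht) (by rw [interior_Iio]; exact hz)
  have hg : AnalyticOnNhd ℂ (fun z : ℂ => (-z) ^ (-y : ℂ) * Real.Gamma y) {z | z.re < 0} := by
    refine DifferentiableOn.analyticOnNhd (fun z hz => ?_) hU
    refine DifferentiableAt.differentiableWithinAt ?_
    refine DifferentiableAt.mul_const (DifferentiableAt.cpow_const ?_ ?_) _
    · fun_prop
    · left; simpa using hz
  have hpre : IsPreconnected {z : ℂ | z.re < 0} :=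
    (convex_halfSpace_re_lt 0).isPreconnected
  have key := hf.eqOn_of_preconnected_of_frequently_eq hg hpre (z₀ := (-1 : ℂ)) (by simp) ?_
  · have := key (x := -s) (by simpa using hs)
    rw [hcm] at this
    simpa using this
  · have hreal : ∀ t : ℝ, t < 0 → ProbabilityTheory.complexMGF id μ t
        = (-(t : ℂ)) ^ (-y : ℂ) * Real.Gamma y := by
      intro t ht
      rw [hcm]
      have h := Real.integral_rpow_mul_exp_neg_mul_Ioi hy (neg_pos.2 ht)
      have h' := congrArg (fun r : ℝ => (r : ℂ)) h
      rw [← integral_complex_ofReal] at h'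
      convert! h' using 1
      · refine setIntegral_congr_fun measurableSet_Ioi fun x hx => ?_
        push_cast
        congr 2
        ring
      · rw [one_div, Real.inv_rpow (by linarith), ← Real.rpow_neg (by linarith)]
        push_cast
        rw [Complex.ofReal_cpow (by linarith)]
        push_cast
        rfl
    -- Real points different from `-1` and accumulating there, as the identity theorem requires.
    have hseq : Tendsto (fun n : ℕ => ((-1 - 1 / ((n : ℝ) + 1) : ℝ) : ℂ)) atTop (𝓝[≠] (-1)) := by
      rw [tendsto_nhdsWithin_iff]
      constructor
      · have h1 : Tendsto (fun n : ℕ => (-1 - 1 / ((n : ℝ) + 1) : ℝ)) atTop (𝓝 (-1 - 0)) :=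
          tendsto_const_nhds.sub tendsto_one_div_add_atTop_nhds_zero_nat
        have := (Complex.continuous_ofReal.tendsto _).comp h1
        simpa [Function.comp_def] using this
      · refine Eventually.of_forall fun n => ?_
        simp only [mem_compl_iff, mem_singleton_iff]
        intro h
        have h2 : (-1 - 1 / ((n : ℝ) + 1) : ℝ) = -1 := by exact_mod_cast h
        have : 0 < 1 / ((n : ℝ) + 1) := by positivity
        linarith
    refine hseq.frequently (Eventually.frequently (Eventually.of_forall fun n => ?_))
    refine hreal _ ?_
    have : 0 < 1 / ((n : ℝ) + 1) := by positivity
    linarith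

end Laplace

/-! ### Laplace transforms of Mittag-Leffler functions. -/

section MittagLefflerLaplace

theorem integrable_tsum_of_summable_integral_norm {α ι : Type*} [MeasurableSpace α]
    {μ : Measure α} [Countable ι] {F : ι → α → ℂ}
    (hm : AEStronglyMeasurable (fun x => ∑' i, F i x) μ)
    (hF : ∀ i, Integrable (F i) μ) (hs : Summable fun i => ∫ x, ‖F i x‖ ∂μ) :
    Integrable (fun x => ∑' i, F i x) μ := by
  refine ⟨hm, ?_⟩
  calc ∫⁻ x, ‖∑' i, F i x‖ₑ ∂μ ≤ ∫⁻ x, ∑' i, ‖F i x‖ₑ ∂μ :=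
        lintegral_mono fun x => enorm_tsum_le_tsum_enorm
    _ = ∑' i, ∫⁻ x, ‖F i x‖ₑ ∂μ := lintegral_tsum fun i => (hF i).1.enorm
    _ = ∑' i, ENNReal.ofReal (∫ x, ‖F i x‖ ∂μ) := by
        congr with i
        rw [ofReal_integral_norm_eq_lintegral_enorm (hF i)]
    _ < ⊤ := by
        rw [← ENNReal.ofReal_tsum_of_nonneg (fun i => integral_nonneg fun x => norm_nonneg _) hs]
        exact ENNReal.ofReal_lt_top

theorem continuousOn_rpow_mul_mittagLeffler₂ {a b : ℝ} (ha : 0 < a) (hb : 0 < b) (c d : ℝ) :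
    ContinuousOn (fun x : ℝ => x ^ d * mittagLeffler₂ a b (-c * x ^ a)) (Ioi 0) := by
  have h : ∀ p : ℝ, ContinuousOn (fun x : ℝ => x ^ p) (Ioi 0) := fun p x hx =>
    (Real.continuousAt_rpow_const x p (Or.inl (ne_of_gt hx))).continuousWithinAt
  exact (h d).mul ((continuous_mittagLeffler₂ ha hb).comp_continuousOn
    (continuousOn_const.mul (h a)))

/-- The `k`-th term transforms to `s ^ (-b) (-c s ^ (-a)) ^ k`, a geometric series. The bound on
`|c|` makes the series of absolute integrals converge, which justifies the interchange. -/
theorem laplace_mittagLeffler₂ {a b c : ℝ} {s : ℂ} (ha : 0 < a) (hb : 0 < b) (hs : 0 < s.re)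
    (hc : |c| < s.re ^ a) :
    IntegrableOn (fun x : ℝ => ((x ^ (b - 1) * mittagLeffler₂ a b (-c * x ^ a) : ℝ) : ℂ)
      * Complex.exp (-s * x)) (Ioi 0) ∧
    ∫ x : ℝ in Ioi 0, ((x ^ (b - 1) * mittagLeffler₂ a b (-c * x ^ a) : ℝ) : ℂ)
      * Complex.exp (-s * x) = s ^ (-b : ℂ) * (1 + c * s ^ (-a : ℂ))⁻¹ := by
  set σ := s.re with hσ
  have hs0 : s ≠ 0 := fun h => by simp [h] at hσ; linarith
  have hy : ∀ k : ℕ, 0 < a * (k : ℝ) + b := fun k => by positivity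
  set F : ℕ → ℝ → ℂ := fun k x => (((-c) ^ k / Real.Gamma (a * k + b) : ℝ) : ℂ) *
    (((x ^ (a * k + b - 1) : ℝ) : ℂ) * Complex.exp (-s * x)) with hF
  have hsum : ∀ x ∈ Ioi (0 : ℝ), ∑' k, F k x =
      ((x ^ (b - 1) * mittagLeffler₂ a b (-c * x ^ a) : ℝ) : ℂ) * Complex.exp (-s * x) := by
    intro x hx
    have hx0 : (0 : ℝ) < x := hx
    have h := (Complex.hasSum_ofReal.2 ((hasSum_mittagLeffler₂ b ha (-c * x ^ a)).mul_left
      (x ^ (b - 1)))).mul_right (Complex.exp (-s * x))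
    rw [← h.tsum_eq]
    congr with k
    rw [hF]
    have : x ^ (a * (k : ℝ) + b - 1) = x ^ (b - 1) * (x ^ a) ^ k := by
      rw [← Real.rpow_natCast, ← Real.rpow_mul hx0.le, ← Real.rpow_add hx0]
      ring_nf
    simp only [this]
    push_cast
    ring
  have hnorm : ∀ k, ∀ x ∈ Ioi (0 : ℝ), ‖F k x‖ = |c| ^ k / Real.Gamma (a * k + b) *
      (x ^ (a * (k : ℝ) + b - 1) * Real.exp (-(σ * x))) := by
    intro k x hx
    have hx0 : (0 : ℝ) < x := hx
    have hG := Gamma_mul_natCast_add_pos ha hb k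
    rw [hF]
    simp only [norm_mul, Complex.norm_real, Complex.norm_exp, norm_div, norm_pow, norm_neg]
    rw [Real.norm_of_nonneg hG.le, Real.norm_of_nonneg (Real.rpow_nonneg hx0.le _)]
    simp [hσ]
  have hint : ∀ k, IntegrableOn (F k) (Ioi 0) := by
    intro k
    have h1 := (integrableOn_rpow_mul_exp_neg_mul (hy k) hs).const_mul
      (|c| ^ k / Real.Gamma (a * k + b))
    refine h1.mono' (by simp only [hF]; fun_prop) ?_
    exact (ae_restrict_iff' measurableSet_Ioi).2 (ae_of_all _ fun x hx => (hnorm k x hx).le)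
  have hsummable : Summable fun k => ∫ x in Ioi (0 : ℝ), ‖F k x‖ := by
    have h2 : ∀ k : ℕ, ∫ x in Ioi (0 : ℝ), ‖F k x‖ = σ ^ (-b) * (|c| / σ ^ a) ^ k := by
      intro k
      have hG := Gamma_mul_natCast_add_pos ha hb k
      rw [setIntegral_congr_fun measurableSet_Ioi (hnorm k), integral_const_mul,
        Real.integral_rpow_mul_exp_neg_mul_Ioi (hy k) hs, one_div, Real.inv_rpow hs.le,
        Real.rpow_add hs, Real.rpow_mul hs.le, Real.rpow_natCast, div_pow, Real.rpow_neg hs.le]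
      field_simp
    simp only [h2]
    refine (summable_geometric_of_lt_one (by positivity) ?_).mul_left _
    rw [div_lt_one (by positivity)]
    exact hc
  have hmeas : AEStronglyMeasurable (fun x => ∑' k, F k x) (volume.restrict (Ioi 0)) := by
    refine ContinuousOn.aestronglyMeasurable ?_ measurableSet_Ioi
    refine ContinuousOn.congr ?_ hsum
    exact (Complex.continuous_ofReal.comp_continuousOn
      (continuousOn_rpow_mul_mittagLeffler₂ ha hb c (b - 1))).mul (by fun_prop)
  have hI := integrable_tsum_of_summable_integral_norm hmeas hint hsummable
  have hH := hasSum_integral_of_summable_integral_norm hint hsummable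
  refine ⟨IntegrableOn.congr_fun hI hsum measurableSet_Ioi, ?_⟩
  rw [← setIntegral_congr_fun measurableSet_Ioi hsum, ← hH.tsum_eq]
  have hterm : ∀ k : ℕ, ∫ x in Ioi (0 : ℝ), F k x = s ^ (-b : ℂ) * (-c * s ^ (-a : ℂ)) ^ k := by
    intro k
    have hG := (Gamma_mul_natCast_add_pos ha hb k).ne'
    have hG' : (Real.Gamma (a * k + b) : ℂ) ≠ 0 := by exact_mod_cast hG
    simp only [hF]
    rw [integral_const_mul, integral_rpow_mul_cexp_neg_mul_Ioi (hy k) hs]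
    have : s ^ (-((a * k + b : ℝ) : ℂ)) = s ^ (-b : ℂ) * (s ^ (-a : ℂ)) ^ k := by
      rw [← Complex.cpow_nat_mul, ← Complex.cpow_add _ _ hs0]
      congr 1
      push_cast
      ring
    rw [this, mul_pow]
    push_cast
    field_simp
  simp only [hterm]
  have hlt : ‖-(c : ℂ) * s ^ (-a : ℂ)‖ < 1 := by
    rw [norm_mul, norm_neg, Complex.norm_real, Real.norm_eq_abs]
    have h1 : ‖s ^ (-a : ℂ)‖ ≤ σ ^ (-a) := by
      have := Complex.norm_cpow_of_ne_zero hs0 (-a : ℂ)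
      rw [this]
      simp only [Complex.neg_re, Complex.ofReal_re, Complex.neg_im, Complex.ofReal_im, neg_zero,
        mul_zero, Real.exp_zero, div_one]
      exact Real.rpow_le_rpow_of_nonpos hs (Complex.re_le_norm s) (by linarith)
    calc |c| * ‖s ^ (-a : ℂ)‖ ≤ |c| * σ ^ (-a) := by gcongr
      _ < σ ^ a * σ ^ (-a) := by gcongr
      _ = 1 := by rw [← Real.rpow_add hs]; simp
  rw [tsum_mul_left, tsum_geometric_of_norm_lt_one hlt]
  congr 2
  ring

end MittagLefflerLaplace

/-! ### Cauchy's formula on the slit plane, in the logarithmic coordinate. -/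

section Strip

open Complex in
-- With `r = e ^ (Re w)` and `y = Im w`, `|e ^ w + c|² = cos²(y/2) (r + c)² + sin²(y/2) (r - c)²`;
-- the second term is dropped.
theorem cos_half_mul_le_norm_exp_add {w : ℂ} {c : ℝ} (hw : |w.im| ≤ Real.pi) (hc : 0 ≤ c) :
    Real.cos (w.im / 2) * (Real.exp w.re + c) ≤ ‖exp w + c‖ := by
  have hcos : 0 ≤ Real.cos (w.im / 2) := by
    have := abs_le.1 hw
    exact Real.cos_nonneg_of_neg_pi_div_two_le_of_le (by linarith) (by linarith)
  have hr := (Real.exp_pos w.re).le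
  rw [← abs_of_nonneg (by positivity : 0 ≤ Real.cos (w.im / 2) * (Real.exp w.re + c)),
    ← abs_of_nonneg (norm_nonneg (exp w + c))]
  rw [← sq_le_sq, mul_pow, Real.cos_sq, Complex.sq_norm, normSq_apply]
  simp only [add_re, exp_re, ofReal_re, add_im, exp_im, ofReal_im, add_zero]
  have h1 : 2 * (w.im / 2) = w.im := by ring
  rw [h1]
  have h2 := Real.sin_sq_add_cos_sq w.im
  have h3 := Real.cos_le_one w.im
  have h4 : (Real.exp w.re * Real.cos w.im + c) * (Real.exp w.re * Real.cos w.im + c)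
      + Real.exp w.re * Real.sin w.im * (Real.exp w.re * Real.sin w.im)
      = (1 / 2 + Real.cos w.im / 2) * (Real.exp w.re + c) ^ 2
        + (Real.exp w.re - c) ^ 2 * (1 - Real.cos w.im) / 2 := by
    linear_combination (Real.exp w.re) ^ 2 * h2
  rw [h4]
  have := mul_nonneg (sq_nonneg (Real.exp w.re - c)) (sub_nonneg.2 h3)
  linarith

theorem cos_half_pos {y : ℝ} (hy : |y| < Real.pi) : 0 < Real.cos (y / 2) := by
  have := abs_lt.1 hy
  exact Real.cos_pos_of_mem_Ioo ⟨by linarith, by linarith⟩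

open Complex in
theorem exp_ne_exp_of_mem_strip {w w₀ : ℂ} (hw : |w.im| ≤ Real.pi) (hw₀ : |w₀.im| < Real.pi)
    (hne : w ≠ w₀) : exp w ≠ exp w₀ := by
  intro h
  obtain ⟨n, hn⟩ := exp_eq_exp_iff_exists_int.1 h
  have him : w.im = w₀.im + n * (2 * Real.pi) := by
    rw [hn]; simp
  have h1 := abs_le.1 hw
  have h2 := abs_lt.1 hw₀
  have hpi := Real.pi_pos
  have hn0 : n = 0 := by
    have h3 : (n : ℝ) < 1 := by
      by_contra! hcon; nlinarith
    have h4 : (-1 : ℝ) < n := by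
      by_contra! hcon; nlinarith
    have h5 : n < 1 := by exact_mod_cast h3
    have h6 : -1 < n := by exact_mod_cast h4
    omega
  apply hne
  rw [hn, hn0]
  simp

open Complex in
-- Makes `w₀` a removable singularity of the Cauchy quotient, with no other singularity in the
-- closed strip.
theorem dslope_exp_ne_zero {w w₀ : ℂ} (hw : |w.im| ≤ Real.pi) (hw₀ : |w₀.im| < Real.pi) :
    dslope exp w₀ w ≠ 0 := by
  by_cases h : w = w₀
  · subst h; simp
  · rw [dslope_of_ne _ h, slope_def_field]
    exact div_ne_zero (sub_ne_zero.2 (exp_ne_exp_of_mem_strip hw hw₀ h)) (sub_ne_zero.2 h)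

/-- The regular part of `(H w - H w₀) e ^ w / (e ^ w - e ^ w₀)`. -/
def stripQuotient (H : ℂ → ℂ) (w₀ w : ℂ) : ℂ :=
  dslope H w₀ w * Complex.exp w / dslope Complex.exp w₀ w

theorem stripQuotient_of_ne (H : ℂ → ℂ) {w₀ w : ℂ} (h : w ≠ w₀) :
    stripQuotient H w₀ w
      = (H w - H w₀) * (Complex.exp w / (Complex.exp w - Complex.exp w₀)) := by
  have h1 : w - w₀ ≠ 0 := sub_ne_zero.2 h
  rw [stripQuotient, dslope_of_ne _ h, dslope_of_ne _ h, slope_def_field, slope_def_field,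
    mul_div_assoc', div_mul_eq_mul_div, div_div_div_cancel_right₀ h1]

variable {H : ℂ → ℂ} {w₀ : ℂ}

theorem continuousAt_stripQuotient (hd : ∀ w : ℂ, |w.im| ≤ Real.pi → DifferentiableAt ℂ H w)
    (hw₀ : |w₀.im| < Real.pi) {w : ℂ} (hw : |w.im| ≤ Real.pi) :
    ContinuousAt (stripQuotient H w₀) w := by
  refine ContinuousAt.div (ContinuousAt.mul ?_ Complex.continuous_exp.continuousAt) ?_
    (dslope_exp_ne_zero hw hw₀)
  · by_cases h : w = w₀
    · subst h; exact continuousAt_dslope_same.2 (hd _ hw)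
    · exact (continuousAt_dslope_of_ne h).2 (hd _ hw).continuousAt
  · by_cases h : w = w₀
    · subst h; exact continuousAt_dslope_same.2 Complex.differentiableAt_exp
    · exact (continuousAt_dslope_of_ne h).2 Complex.continuous_exp.continuousAt

theorem differentiableAt_stripQuotient
    (hd : ∀ w : ℂ, |w.im| ≤ Real.pi → DifferentiableAt ℂ H w)
    (hw₀ : |w₀.im| < Real.pi) {w : ℂ} (hw : |w.im| ≤ Real.pi) (h : w ≠ w₀) :
    DifferentiableAt ℂ (stripQuotient H w₀) w := by
  refine DifferentiableAt.div (DifferentiableAt.mul ?_ Complex.differentiableAt_exp) ?_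
    (dslope_exp_ne_zero hw hw₀)
  · exact (differentiableAt_dslope_of_ne h).2 (hd _ hw)
  · exact (differentiableAt_dslope_of_ne h).2 Complex.differentiableAt_exp

/-- Cauchy–Goursat with `w₀` as an exceptional point: continuity there is enough, so
differentiability of `dslope` at `w₀` is never needed. -/
theorem stripQuotient_rect (hd : ∀ w : ℂ, |w.im| ≤ Real.pi → DifferentiableAt ℂ H w)
    (hw₀ : |w₀.im| < Real.pi) (R : ℝ) :
    (∫ x in (-R)..R, stripQuotient H w₀ (x + (-Real.pi : ℝ) * Complex.I))
      - (∫ x in (-R)..R, stripQuotient H w₀ (x + Real.pi * Complex.I))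
      + Complex.I * (∫ y in (-Real.pi)..Real.pi, stripQuotient H w₀ (R + y * Complex.I))
      - Complex.I * (∫ y in (-Real.pi)..Real.pi,
          stripQuotient H w₀ ((-R : ℝ) + y * Complex.I)) = 0 := by
  have hpi := Real.pi_pos
  have key := Complex.integral_boundary_rect_eq_zero_of_differentiable_on_off_countable
    (stripQuotient H w₀) ⟨-R, -Real.pi⟩ ⟨R, Real.pi⟩ {w₀} (countable_singleton _) ?_ ?_
  · simpa using key
  · intro w hw
    refine (continuousAt_stripQuotient hd hw₀ ?_).continuousWithinAt
    have := hw.2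
    simp only [mem_preimage] at this
    rw [uIcc_of_le (by linarith)] at this
    exact abs_le.2 this
  · intro w hw
    have h2 := hw.1.2
    simp only [mem_preimage] at h2
    rw [min_eq_left (by linarith), max_eq_right (by linarith)] at h2
    exact differentiableAt_stripQuotient hd hw₀ (abs_le.2 ⟨h2.1.le, h2.2.le⟩) hw.2

theorem integrable_of_norm_le_exp {f : ℝ → ℂ} (hf : Continuous f) {A B p q : ℝ} (hp : 0 < p)
    (hq : 0 < q) (h1 : ∀ x, 0 ≤ x → ‖f x‖ ≤ A * Real.exp (-p * x))
    (h2 : ∀ x, x ≤ 0 → ‖f x‖ ≤ B * Real.exp (q * x)) : Integrable f := by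
  rw [← integrableOn_univ, ← Iic_union_Ioi (a := (0 : ℝ))]
  refine IntegrableOn.union ?_ ?_
  · refine ((integrableOn_exp_mul_Iic hq 0).const_mul B).mono' hf.aestronglyMeasurable ?_
    exact (ae_restrict_iff' measurableSet_Iic).2 (ae_of_all _ fun x hx => h2 x hx)
  · refine ((integrableOn_exp_mul_Ioi (neg_lt_zero.2 hp) 0).const_mul A).mono'
      hf.aestronglyMeasurable ?_
    exact (ae_restrict_iff' measurableSet_Ioi).2 (ae_of_all _ fun x hx => h1 x (le_of_lt hx))

/-- The jump of `H` across the boundary of the strip, against the Stieltjes kernel. -/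
def stripJump (H : ℂ → ℂ) (w₀ : ℂ) (x : ℝ) : ℂ :=
  (H (x + (-Real.pi : ℝ) * Complex.I) - H (x + Real.pi * Complex.I))
    * (Complex.exp x / (Complex.exp x + Complex.exp w₀))

theorem cexp_ofReal_add_cexp_ne_zero (hw₀ : |w₀.im| < Real.pi) (x : ℝ) :
    Complex.exp x + Complex.exp w₀ ≠ 0 := by
  have h := cos_half_mul_le_norm_exp_add hw₀.le (Real.exp_pos x).le
  have h1 := cos_half_pos hw₀
  rw [add_comm, ← norm_pos_iff]
  rw [Complex.ofReal_exp] at h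
  refine lt_of_lt_of_le ?_ h
  positivity

theorem norm_kernel_le (hw₀ : |w₀.im| < Real.pi) (x : ℝ) :
    ‖Complex.exp x / (Complex.exp x + Complex.exp w₀)‖
      ≤ Real.exp x / (Real.cos (w₀.im / 2) * (Real.exp w₀.re + Real.exp x)) := by
  have h := cos_half_mul_le_norm_exp_add hw₀.le (Real.exp_pos x).le
  have h1 := cos_half_pos hw₀
  rw [Complex.ofReal_exp] at h
  rw [norm_div, Complex.norm_exp_ofReal, add_comm (Complex.exp x)]
  gcongr

/-- Since `e ^ (x ± iπ) = -e ^ x`, the kernel agrees on the two horizontal edges and the `H w₀`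
terms cancel, leaving only the jump of `H`. -/
theorem stripQuotient_sub (H : ℂ → ℂ) (hw₀ : |w₀.im| < Real.pi) (x : ℝ) :
    stripQuotient H w₀ (x + (-Real.pi : ℝ) * Complex.I)
      - stripQuotient H w₀ (x + Real.pi * Complex.I) = stripJump H w₀ x := by
  have h := abs_lt.1 hw₀
  have e1 : Complex.exp (x + (-Real.pi : ℝ) * Complex.I) = -Complex.exp x := by
    rw [Complex.exp_add]; simp [Complex.exp_neg]
  have e2 : Complex.exp (x + Real.pi * Complex.I) = -Complex.exp x := by
    rw [Complex.exp_add]; simp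
  have hne := cexp_ofReal_add_cexp_ne_zero hw₀ x
  rw [stripQuotient_of_ne, stripQuotient_of_ne, e1, e2, stripJump]
  · have : -Complex.exp (x : ℂ) / (-Complex.exp x - Complex.exp w₀)
        = Complex.exp x / (Complex.exp x + Complex.exp w₀) := by
      rw [← neg_div_neg_eq]; congr 1 <;> ring
    rw [this]
    ring
  · intro h'; have := congrArg Complex.im h'; simp at this; linarith
  · intro h'; have := congrArg Complex.im h'; simp at this; linarith

variable {C β γ : ℝ}

theorem continuous_stripJump (hd : ∀ w : ℂ, |w.im| ≤ Real.pi → DifferentiableAt ℂ H w)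
    (hw₀ : |w₀.im| < Real.pi) : Continuous (stripJump H w₀) := by
  have hpi := Real.pi_pos
  have h : ∀ y : ℝ, |y| ≤ Real.pi → Continuous fun x : ℝ => H (x + y * Complex.I) := by
    intro y hy
    refine continuous_iff_continuousAt.2 fun x => ?_
    have : ContinuousAt H (x + y * Complex.I) := (hd _ (by simpa using hy)).continuousAt
    exact ContinuousAt.comp this (by fun_prop)
  refine Continuous.mul ?_ ?_
  · exact (h (-Real.pi) (by rw [abs_neg, abs_of_pos hpi])).sub
      (h Real.pi (by rw [abs_of_pos hpi]))
  · exact Continuous.div (by fun_prop) (by fun_prop) (cexp_ofReal_add_cexp_ne_zero hw₀)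

/-- The kernel is bounded at `+∞` and `O(e ^ x)` at `-∞`, so the jump decays at rates `β` and `1 -
γ` respectively. -/
theorem integrable_stripJump (hd : ∀ w : ℂ, |w.im| ≤ Real.pi → DifferentiableAt ℂ H w)
    (hβ : 0 < β) (hγ : γ < 1)
    (hR : ∀ w : ℂ, |w.im| ≤ Real.pi → 0 ≤ w.re → ‖H w‖ ≤ C * Real.exp (-β * w.re))
    (hL : ∀ w : ℂ, |w.im| ≤ Real.pi → w.re ≤ 0 → ‖H w‖ ≤ C * Real.exp (-γ * w.re))
    (hw₀ : |w₀.im| < Real.pi) : Integrable (stripJump H w₀) := by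
  have hpi := Real.pi_pos
  have h1 := cos_half_pos hw₀
  set κ := Real.cos (w₀.im / 2)
  have b1 : |(-Real.pi)| ≤ Real.pi := by rw [abs_neg, abs_of_pos hpi]
  have b2 : |Real.pi| ≤ Real.pi := by rw [abs_of_pos hpi]
  refine integrable_of_norm_le_exp (A := 2 * C * κ⁻¹) (B := 2 * C * (κ * Real.exp w₀.re)⁻¹)
    (p := β) (q := 1 - γ) (continuous_stripJump hd hw₀) hβ (by linarith) ?_ ?_
  · intro x hx
    rw [stripJump, norm_mul]
    have h3 := hR (x + (-Real.pi : ℝ) * Complex.I) (by simpa using b1) (by simpa using hx)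
    have h4 := hR (x + Real.pi * Complex.I) (by simpa using b2) (by simpa using hx)
    have h5 : ‖Complex.exp x / (Complex.exp x + Complex.exp w₀)‖ ≤ κ⁻¹ := by
      refine (norm_kernel_le hw₀ x).trans ?_
      rw [div_le_iff₀ (by positivity)]
      have := Real.exp_pos w₀.re
      rw [inv_mul_cancel_left₀ h1.ne']
      linarith
    have h6 := norm_sub_le (H (x + (-Real.pi : ℝ) * Complex.I)) (H (x + Real.pi * Complex.I))
    simp only [Complex.add_re, Complex.ofReal_re, Complex.mul_re, Complex.I_re, mul_zero,
      Complex.ofReal_im, Complex.I_im, zero_mul, sub_zero, add_zero] at h3 h4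
    calc _ ≤ (2 * C * Real.exp (-β * x)) * κ⁻¹ := by
          refine mul_le_mul (by linarith) h5 (norm_nonneg _) ?_
          have := (norm_nonneg _).trans h3
          linarith
      _ = _ := by ring
  · intro x hx
    rw [stripJump, norm_mul]
    have h3 := hL (x + (-Real.pi : ℝ) * Complex.I) (by simpa using b1) (by simpa using hx)
    have h4 := hL (x + Real.pi * Complex.I) (by simpa using b2) (by simpa using hx)
    have h5 : ‖Complex.exp x / (Complex.exp x + Complex.exp w₀)‖
        ≤ Real.exp x * (κ * Real.exp w₀.re)⁻¹ := by
      refine (norm_kernel_le hw₀ x).trans ?_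
      rw [← div_eq_mul_inv]
      have := Real.exp_pos x
      gcongr
      linarith
    have h6 := norm_sub_le (H (x + (-Real.pi : ℝ) * Complex.I)) (H (x + Real.pi * Complex.I))
    simp only [Complex.add_re, Complex.ofReal_re, Complex.mul_re, Complex.I_re, mul_zero,
      Complex.ofReal_im, Complex.I_im, zero_mul, sub_zero, add_zero] at h3 h4
    calc _ ≤ (2 * C * Real.exp (-γ * x)) * (Real.exp x * (κ * Real.exp w₀.re)⁻¹) := by
          refine mul_le_mul (by linarith) h5 (norm_nonneg _) ?_
          have := (norm_nonneg _).trans h3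
          linarith
      _ = _ := by
          have : Real.exp ((1 - γ) * x) = Real.exp (-γ * x) * Real.exp x := by
            rw [← Real.exp_add]; ring_nf
          rw [this]
          ring

/-- At the right edge `H` tends to `0` and the kernel to `1`, so the quotient tends to `-H w₀` along
an edge of length `2π`. This is the source of the value in Cauchy's formula. -/
theorem tendsto_stripQuotient_right
    (hd : ∀ w : ℂ, |w.im| ≤ Real.pi → DifferentiableAt ℂ H w) (hβ : 0 < β)
    (hR : ∀ w : ℂ, |w.im| ≤ Real.pi → 0 ≤ w.re → ‖H w‖ ≤ C * Real.exp (-β * w.re))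
    (hw₀ : |w₀.im| < Real.pi) :
    Tendsto (fun R : ℝ => ∫ y in (-Real.pi)..Real.pi, stripQuotient H w₀ (R + y * Complex.I))
      atTop (𝓝 (-(2 * Real.pi * H w₀))) := by
  have hpi := Real.pi_pos
  rw [← tendsto_sub_nhds_zero_iff]
  set S := Real.exp w₀.re with hS
  have hS0 : 0 < S := Real.exp_pos _
  have hlim : Tendsto (fun R : ℝ => (C * Real.exp (-β * R) * (1 + S * (Real.exp R - S)⁻¹)
      + ‖H w₀‖ * (S * (Real.exp R - S)⁻¹)) * |Real.pi - -Real.pi|) atTop (𝓝 0) := by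
    have t1 : Tendsto (fun R : ℝ => Real.exp (-β * R)) atTop (𝓝 0) :=
      Real.tendsto_exp_atBot.comp (tendsto_id.const_mul_atTop_of_neg (neg_lt_zero.2 hβ))
    have t2 : Tendsto (fun R : ℝ => (Real.exp R - S)⁻¹) atTop (𝓝 0) :=
      (tendsto_atTop_add_const_right _ (-S) Real.tendsto_exp_atTop).inv_tendsto_atTop
    have := (((t1.const_mul C).mul ((t2.const_mul S).const_add 1)).add
      ((t2.const_mul S).const_mul ‖H w₀‖)).mul_const |Real.pi - -Real.pi|
    simpa using this
  refine squeeze_zero_norm' ?_ hlim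
  filter_upwards [eventually_gt_atTop 0, eventually_gt_atTop w₀.re] with R hR0 hRw
  have hES : 0 < Real.exp R - S := sub_pos.2 (Real.exp_lt_exp.2 hRw)
  have hcont : ContinuousOn (fun y : ℝ => stripQuotient H w₀ (R + y * Complex.I))
      (uIcc (-Real.pi) Real.pi) := by
    intro y hy
    rw [uIcc_of_le (by linarith)] at hy
    refine ContinuousAt.continuousWithinAt ?_
    exact ContinuousAt.comp (continuousAt_stripQuotient hd hw₀ (by simpa using abs_le.2 hy))
      (by fun_prop)
  have hsplit : (∫ y in (-Real.pi)..Real.pi, stripQuotient H w₀ (R + y * Complex.I))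
      - -(2 * Real.pi * H w₀)
      = ∫ y in (-Real.pi)..Real.pi, (stripQuotient H w₀ (R + y * Complex.I) + H w₀) := by
    rw [intervalIntegral.integral_add hcont.intervalIntegrable (by simp),
      intervalIntegral.integral_const, Complex.real_smul]
    push_cast
    ring
  rw [hsplit]
  refine intervalIntegral.norm_integral_le_of_norm_le_const fun y hy => ?_
  rw [uIoc_of_le (by linarith)] at hy
  have hne : (R + y * Complex.I : ℂ) ≠ w₀ := by
    intro h; have := congrArg Complex.re h; simp at this; linarith
  have him : |(R + y * Complex.I : ℂ).im| ≤ Real.pi := by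
    simpa using abs_le.2 ⟨hy.1.le, hy.2⟩
  have hre : (R + y * Complex.I : ℂ).re = R := by simp
  rw [stripQuotient_of_ne H hne]
  set w : ℂ := R + y * Complex.I
  have hn1 : ‖Complex.exp w‖ = Real.exp R := by rw [Complex.norm_exp, hre]
  have hn2 : ‖Complex.exp w₀‖ = S := Complex.norm_exp _
  have hn3 : Real.exp R - S ≤ ‖Complex.exp w - Complex.exp w₀‖ := by
    rw [← hn1, ← hn2]; exact norm_sub_norm_le _ _
  have hne2 : Complex.exp w - Complex.exp w₀ ≠ 0 := norm_pos_iff.1 (hES.trans_le hn3)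
  have hT : ‖Complex.exp w₀ / (Complex.exp w - Complex.exp w₀)‖ ≤ S * (Real.exp R - S)⁻¹ := by
    rw [norm_div, hn2, ← div_eq_mul_inv]; gcongr
  have hHw := hR w him (by rw [hre]; exact hR0.le)
  rw [hre] at hHw
  have hEq : (H w - H w₀) * (Complex.exp w / (Complex.exp w - Complex.exp w₀)) + H w₀
      = H w * (1 + Complex.exp w₀ / (Complex.exp w - Complex.exp w₀))
        - H w₀ * (Complex.exp w₀ / (Complex.exp w - Complex.exp w₀)) := by
    field_simp
    ring
  rw [hEq]
  refine (norm_sub_le _ _).trans ?_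
  rw [norm_mul, norm_mul]
  gcongr
  · exact (norm_nonneg _).trans hHw
  · exact (norm_add_le _ _).trans (by rw [norm_one]; gcongr)

/-- The kernel is `O(e ^ (-R))` on the left edge and beats the growth `e ^ (γR)` of `H`, because `γ
< 1`. -/
theorem tendsto_stripQuotient_left (hγ : γ < 1)
    (hL : ∀ w : ℂ, |w.im| ≤ Real.pi → w.re ≤ 0 → ‖H w‖ ≤ C * Real.exp (-γ * w.re)) :
    Tendsto (fun R : ℝ => ∫ y in (-Real.pi)..Real.pi,
      stripQuotient H w₀ ((-R : ℝ) + y * Complex.I)) atTop (𝓝 0) := by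
  have hpi := Real.pi_pos
  set S := Real.exp w₀.re with hS
  have hS0 : 0 < S := Real.exp_pos _
  have tneg : ∀ p : ℝ, 0 < p → Tendsto (fun R : ℝ => Real.exp (-p * R)) atTop (𝓝 0) :=
    fun p hp => Real.tendsto_exp_atBot.comp
      (tendsto_id.const_mul_atTop_of_neg (neg_lt_zero.2 hp))
  have hlim : Tendsto (fun R : ℝ => ((C * Real.exp (-(1 - γ) * R) + ‖H w₀‖ * Real.exp (-1 * R))
      * (S - Real.exp (-1 * R))⁻¹) * |Real.pi - -Real.pi|) atTop (𝓝 0) := by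
    have t3 : Tendsto (fun R : ℝ => (S - Real.exp (-1 * R))⁻¹) atTop (𝓝 (S - 0)⁻¹) :=
      ((tneg 1 one_pos).const_sub S).inv₀ (by simpa using hS0.ne')
    have := (((((tneg (1 - γ) (by linarith)).const_mul C).add
      ((tneg 1 one_pos).const_mul ‖H w₀‖))).mul t3).mul_const |Real.pi - -Real.pi|
    simpa using this
  refine squeeze_zero_norm' ?_ hlim
  filter_upwards [eventually_gt_atTop 0, eventually_gt_atTop (-w₀.re)] with R hR0 hRw
  have hES : 0 < S - Real.exp (-1 * R) := sub_pos.2 (Real.exp_lt_exp.2 (by linarith))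
  refine intervalIntegral.norm_integral_le_of_norm_le_const fun y hy => ?_
  rw [uIoc_of_le (by linarith)] at hy
  have hne : ((-R : ℝ) + y * Complex.I : ℂ) ≠ w₀ := by
    intro h; have := congrArg Complex.re h; simp at this; linarith
  have him : |((-R : ℝ) + y * Complex.I : ℂ).im| ≤ Real.pi := by
    simpa using abs_le.2 ⟨hy.1.le, hy.2⟩
  have hre : ((-R : ℝ) + y * Complex.I : ℂ).re = -R := by simp
  rw [stripQuotient_of_ne H hne]
  set w : ℂ := (-R : ℝ) + y * Complex.I
  have hn1 : ‖Complex.exp w‖ = Real.exp (-1 * R) := by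
    rw [Complex.norm_exp, hre]; ring_nf
  have hn2 : ‖Complex.exp w₀‖ = S := Complex.norm_exp _
  have hn3 : S - Real.exp (-1 * R) ≤ ‖Complex.exp w - Complex.exp w₀‖ := by
    rw [← hn1, ← hn2, norm_sub_rev]; exact norm_sub_norm_le _ _
  have hHw := hL w him (by rw [hre]; linarith)
  rw [hre] at hHw
  rw [norm_mul, norm_div, hn1]
  calc ‖H w - H w₀‖ * (Real.exp (-1 * R) / ‖Complex.exp w - Complex.exp w₀‖)
      ≤ (C * Real.exp (-γ * -R) + ‖H w₀‖)
        * (Real.exp (-1 * R) / (S - Real.exp (-1 * R))) := by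
        gcongr
        · exact add_nonneg ((norm_nonneg _).trans hHw) (norm_nonneg _)
        · exact (norm_sub_le _ _).trans (by gcongr)
    _ = _ := by
        have : Real.exp (-(1 - γ) * R) = Real.exp (-γ * -R) * Real.exp (-1 * R) := by
          rw [← Real.exp_add]; ring_nf
        rw [this]
        ring

/-- Cauchy's integral formula in the strip `|Im w| ≤ π` for the kernel `e ^ w / (e ^ w - e ^ w₀)`;
under `z = e ^ w` this is the Stieltjes representation of a function on the slit plane. -/
theorem integral_stripJump (hd : ∀ w : ℂ, |w.im| ≤ Real.pi → DifferentiableAt ℂ H w)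
    (hβ : 0 < β) (hγ : γ < 1)
    (hR : ∀ w : ℂ, |w.im| ≤ Real.pi → 0 ≤ w.re → ‖H w‖ ≤ C * Real.exp (-β * w.re))
    (hL : ∀ w : ℂ, |w.im| ≤ Real.pi → w.re ≤ 0 → ‖H w‖ ≤ C * Real.exp (-γ * w.re))
    (hw₀ : |w₀.im| < Real.pi) :
    ∫ x : ℝ, stripJump H w₀ x = 2 * Real.pi * Complex.I * H w₀ := by
  have hpi := Real.pi_pos
  have hI := integrable_stripJump hd hβ hγ hR hL hw₀
  have hlim := intervalIntegral_tendsto_integral hI (a := fun R : ℝ => -R) (b := fun R => R)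
    (l := atTop) tendsto_neg_atTop_atBot tendsto_id
  have hcont : ∀ y : ℝ, |y| ≤ Real.pi →
      Continuous fun x : ℝ => stripQuotient H w₀ (x + y * Complex.I) := by
    intro y hy
    refine continuous_iff_continuousAt.2 fun x => ?_
    exact ContinuousAt.comp (continuousAt_stripQuotient hd hw₀ (by simpa using hy))
      (by fun_prop)
  have heq : ∀ R : ℝ, ∫ x in (-R)..R, stripJump H w₀ x =
      Complex.I * (∫ y in (-Real.pi)..Real.pi, stripQuotient H w₀ ((-R : ℝ) + y * Complex.I))
      - Complex.I * (∫ y in (-Real.pi)..Real.pi, stripQuotient H w₀ (R + y * Complex.I)) := by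
    intro R
    have h := stripQuotient_rect hd hw₀ R
    rw [← intervalIntegral.integral_sub] at h
    · simp only [stripQuotient_sub H hw₀] at h
      linear_combination h
    · exact (hcont (-Real.pi) (by rw [abs_neg, abs_of_pos hpi])).intervalIntegrable _ _
    · exact (hcont Real.pi (by rw [abs_of_pos hpi])).intervalIntegrable _ _
  simp only [heq] at hlim
  have hlim2 := ((tendsto_stripQuotient_left (w₀ := w₀) hγ hL).const_mul Complex.I).sub
    ((tendsto_stripQuotient_right hd hβ hR hw₀).const_mul Complex.I)
  rw [tendsto_nhds_unique hlim hlim2]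
  ring

end Strip

/-! ### The symbol on the closed strip and its Stieltjes representation. -/

section Symbol

/-- The Laplace transform `(θ z ^ (a - 1) + c) / (z ^ a + c)` in the coordinate `z = e ^ w`. -/
def tmlSymbol (a c θ : ℝ) (w : ℂ) : ℂ :=
  (θ * Complex.exp (((a : ℂ) - 1) * w) + c) / (Complex.exp (a * w) + c)

theorem tmlSymbol_log {a c θ : ℝ} {z : ℂ} (hz : z ≠ 0) :
    tmlSymbol a c θ (Complex.log z) = (θ * z ^ ((a : ℂ) - 1) + c) / (z ^ (a : ℂ) + c) := by
  rw [tmlSymbol, Complex.cpow_def_of_ne_zero hz, Complex.cpow_def_of_ne_zero hz,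
    mul_comm (Complex.log z), mul_comm (Complex.log z)]

theorem tmlSymbol_conj (a c θ : ℝ) (w : ℂ) :
    tmlSymbol a c θ (starRingEnd ℂ w) = starRingEnd ℂ (tmlSymbol a c θ w) := by
  simp only [tmlSymbol, map_div₀, map_add, map_mul, ← Complex.exp_conj, Complex.conj_ofReal,
    map_sub, map_one]

variable {a c θ : ℝ} {w : ℂ}

/-- Here `a < 1` matters: `|Im (a w)| ≤ aπ < π`, so the cosine factor stays at least `cos(aπ/2) > 0`
up to the boundary of the strip. -/
theorem tmlSymbol_denom_bound (ha0 : 0 < a) (ha1 : a < 1) (hc : 0 < c)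
    (hw : |w.im| ≤ Real.pi) :
    Real.cos (a * Real.pi / 2) * (Real.exp (a * w.re) + c) ≤ ‖Complex.exp (a * w) + c‖ := by
  have hpi := Real.pi_pos
  have him : ((a : ℂ) * w).im = a * w.im := by simp
  have hre : ((a : ℂ) * w).re = a * w.re := by simp
  have h1 : |a * w.im| ≤ a * Real.pi := by
    rw [abs_mul, abs_of_pos ha0]; gcongr
  have h2 : a * Real.pi ≤ Real.pi := by nlinarith
  have h := cos_half_mul_le_norm_exp_add (w := a * w) (c := c) (by rw [him]; linarith) hc.le
  rw [hre, him] at h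
  refine le_trans ?_ h
  gcongr
  rw [← Real.cos_abs (a * w.im / 2), abs_div, abs_two]
  refine Real.cos_le_cos_of_nonneg_of_le_pi (by positivity) (by linarith) (by linarith)

theorem cos_mul_pi_half_pos (ha0 : 0 < a) (ha1 : a < 1) : 0 < Real.cos (a * Real.pi / 2) := by
  have hpi := Real.pi_pos
  refine Real.cos_pos_of_mem_Ioo ⟨?_, ?_⟩
  · have : 0 < a * Real.pi := by positivity
    linarith
  · nlinarith

theorem tmlSymbol_denom_ne_zero (ha0 : 0 < a) (ha1 : a < 1) (hc : 0 < c)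
    (hw : |w.im| ≤ Real.pi) : Complex.exp (a * w) + c ≠ 0 := by
  rw [← norm_pos_iff]
  refine lt_of_lt_of_le ?_ (tmlSymbol_denom_bound ha0 ha1 hc hw)
  have := cos_mul_pi_half_pos ha0 ha1
  positivity

theorem differentiableAt_tmlSymbol (ha0 : 0 < a) (ha1 : a < 1) (hc : 0 < c)
    (hw : |w.im| ≤ Real.pi) : DifferentiableAt ℂ (tmlSymbol a c θ) w :=
  DifferentiableAt.div (by fun_prop) (by fun_prop) (tmlSymbol_denom_ne_zero ha0 ha1 hc hw)

theorem norm_tmlSymbol_le (ha0 : 0 < a) (ha1 : a < 1) (hc : 0 < c) (hθ : 0 < θ)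
    (hw : |w.im| ≤ Real.pi) :
    ‖tmlSymbol a c θ w‖ ≤ (θ * Real.exp ((a - 1) * w.re) + c)
      / (Real.cos (a * Real.pi / 2) * (Real.exp (a * w.re) + c)) := by
  have hκ := cos_mul_pi_half_pos ha0 ha1
  rw [tmlSymbol, norm_div]
  have hnum : ‖(θ : ℂ) * Complex.exp (((a : ℂ) - 1) * w) + c‖
      ≤ θ * Real.exp ((a - 1) * w.re) + c := by
    refine (norm_add_le _ _).trans (le_of_eq ?_)
    rw [norm_mul, Complex.norm_real, Complex.norm_real, Complex.norm_exp,
      Real.norm_of_nonneg hθ.le, Real.norm_of_nonneg hc.le]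
    simp
  have := tmlSymbol_denom_bound ha0 ha1 hc hw
  gcongr

/-- The factor `1 + c⁻¹` dominates both `1` and `c⁻¹`, so one constant serves at both ends of the
strip. -/
theorem norm_tmlSymbol_le_right (ha0 : 0 < a) (ha1 : a < 1) (hc : 0 < c) (hθ : 0 < θ)
    (hw : |w.im| ≤ Real.pi) (hx : 0 ≤ w.re) :
    ‖tmlSymbol a c θ w‖ ≤ (θ + c) / Real.cos (a * Real.pi / 2) * (1 + c⁻¹)
      * Real.exp (-a * w.re) := by
  have hκ := cos_mul_pi_half_pos ha0 ha1
  have h1 : Real.exp ((a - 1) * w.re) ≤ 1 := Real.exp_le_one_iff.2 (by nlinarith)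
  have hE := Real.exp_pos (a * w.re)
  have hc' : 0 < c⁻¹ := inv_pos.2 hc
  calc ‖tmlSymbol a c θ w‖ ≤ _ := norm_tmlSymbol_le ha0 ha1 hc hθ hw
    _ ≤ (θ * 1 + c) / (Real.cos (a * Real.pi / 2) * Real.exp (a * w.re)) := by
        gcongr; linarith
    _ = (θ + c) / Real.cos (a * Real.pi / 2) * 1 * Real.exp (-a * w.re) := by
        rw [neg_mul, Real.exp_neg]; field_simp
    _ ≤ _ := by gcongr; linarith

theorem norm_tmlSymbol_le_left (ha0 : 0 < a) (ha1 : a < 1) (hc : 0 < c) (hθ : 0 < θ)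
    (hw : |w.im| ≤ Real.pi) (hx : w.re ≤ 0) :
    ‖tmlSymbol a c θ w‖ ≤ (θ + c) / Real.cos (a * Real.pi / 2) * (1 + c⁻¹)
      * Real.exp (-(1 - a) * w.re) := by
  have hκ := cos_mul_pi_half_pos ha0 ha1
  have h1 : 1 ≤ Real.exp ((a - 1) * w.re) := Real.one_le_exp (by nlinarith)
  have hE := Real.exp_pos (a * w.re)
  have hc' : 0 < c⁻¹ := inv_pos.2 hc
  calc ‖tmlSymbol a c θ w‖ ≤ _ := norm_tmlSymbol_le ha0 ha1 hc hθ hw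
    _ ≤ (θ * Real.exp ((a - 1) * w.re) + c * Real.exp ((a - 1) * w.re))
          / (Real.cos (a * Real.pi / 2) * c) := by
        gcongr
        · nlinarith
        · linarith
    _ = (θ + c) / Real.cos (a * Real.pi / 2) * c⁻¹ * Real.exp ((a - 1) * w.re) := by
        field_simp
    _ ≤ _ := by
        have : (a - 1) * w.re = -(1 - a) * w.re := by ring
        rw [this]
        gcongr
        linarith

/-- With `y = Im w`, `p = e ^ ((a - 1) Re w)` and `q = e ^ (a Re w)`, numerator times conjugate
denominator has imaginary part `-(θpq sin y + θpc sin((1 - a)y) + cq sin(ay))`. At `y = π` the first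
term vanishes but the other two remain positive. -/
theorem tmlSymbol_im_neg (ha0 : 0 < a) (ha1 : a < 1) (hc : 0 < c) (hθ : 0 < θ)
    (h0 : 0 < w.im) (h1 : w.im ≤ Real.pi) : (tmlSymbol a c θ w).im < 0 := by
  have hne := tmlSymbol_denom_ne_zero ha0 ha1 hc (w := w) (by rw [abs_of_pos h0]; exact h1)
  have hN := Complex.normSq_pos.2 hne
  rw [tmlSymbol, Complex.div_im, ← sub_div]
  refine div_neg_of_neg_of_pos ?_ hN
  simp only [Complex.add_im, Complex.add_re, Complex.mul_im, Complex.mul_re, Complex.exp_re,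
    Complex.exp_im, Complex.ofReal_re, Complex.ofReal_im, Complex.sub_re, Complex.sub_im,
    Complex.one_re, Complex.one_im, zero_mul, sub_zero, add_zero]
  set p := Real.exp ((a - 1) * w.re)
  set q := Real.exp (a * w.re)
  have hp : 0 < p := Real.exp_pos _
  have hq : 0 < q := Real.exp_pos _
  have s1 : 0 ≤ Real.sin w.im := Real.sin_nonneg_of_nonneg_of_le_pi h0.le h1
  have s2 : 0 < Real.sin ((1 - a) * w.im) :=
    Real.sin_pos_of_pos_of_lt_pi (mul_pos (by linarith) h0) (by nlinarith)
  have s3 : 0 < Real.sin (a * w.im) :=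
    Real.sin_pos_of_pos_of_lt_pi (mul_pos ha0 h0) (by nlinarith)
  have e1 : Real.sin ((1 - a) * w.im) = -Real.sin ((a - 1) * w.im) := by
    rw [← Real.sin_neg]; ring_nf
  have e2 : Real.sin w.im = Real.sin (a * w.im) * Real.cos ((a - 1) * w.im)
      - Real.cos (a * w.im) * Real.sin ((a - 1) * w.im) := by
    rw [← Real.sin_sub]; ring_nf
  have key : 0 < θ * p * q * Real.sin w.im + θ * p * c * Real.sin ((1 - a) * w.im)
      + c * q * Real.sin (a * w.im) := by positivity
  rw [e2, e1] at key
  nlinarith [key]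

theorem tmlSymbol_mem_slitPlane (ha0 : 0 < a) (ha1 : a < 1) (hc : 0 < c) (hθ : 0 < θ)
    (hw : |w.im| ≤ Real.pi) : tmlSymbol a c θ w ∈ Complex.slitPlane := by
  rw [Complex.mem_slitPlane_iff]
  have hw' := abs_le.1 hw
  rcases lt_trichotomy w.im 0 with h | h | h
  · right
    have h2 := tmlSymbol_im_neg (w := starRingEnd ℂ w) ha0 ha1 hc hθ (by simpa using h)
      (by simp; linarith)
    rw [tmlSymbol_conj, Complex.conj_im] at h2
    intro h3
    rw [h3] at h2
    simp at h2
  · left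
    have hwr : w = (w.re : ℂ) := Complex.ext rfl (by simpa using h)
    rw [hwr]
    have : tmlSymbol a c θ (w.re : ℂ)
        = (((θ * Real.exp ((a - 1) * w.re) + c) / (Real.exp (a * w.re) + c) : ℝ) : ℂ) := by
      rw [tmlSymbol]; push_cast; rfl
    rw [this, Complex.ofReal_re]
    positivity
  · right
    exact (tmlSymbol_im_neg ha0 ha1 hc hθ h hw'.2).ne

/-- The argument lies in `(-π, 0]`, and multiplying it by `p ∈ [0, 1]` keeps it there. -/
theorem Complex.im_cpow_nonpos {z : ℂ} (hz : z.im ≤ 0) (hz' : z ∈ Complex.slitPlane) {p : ℝ}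
    (hp0 : 0 ≤ p) (hp1 : p ≤ 1) : (z ^ (p : ℂ)).im ≤ 0 := by
  have h0 : z ≠ 0 := Complex.slitPlane_ne_zero hz'
  have hpi := Real.pi_pos
  rw [Complex.cpow_def_of_ne_zero h0, Complex.exp_im]
  refine mul_nonpos_of_nonneg_of_nonpos (Real.exp_pos _).le ?_
  have him : (Complex.log z * p).im = z.arg * p := by simp [Complex.log_im]
  have h1 : z.arg ≤ 0 := by
    rcases hz.lt_or_eq with h | h
    · exact (Complex.arg_neg_iff.2 h).le
    · have : 0 < z.re := by
        rcases Complex.mem_slitPlane_iff.1 hz' with h2 | h2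
        · exact h2
        · exact absurd h h2
      rw [Complex.arg_eq_zero_iff.2 ⟨this.le, h⟩]
  have h2 := Complex.neg_pi_lt_arg z
  rw [him]
  refine Real.sin_nonpos_of_nonpos_of_neg_pi_le ?_ ?_
  · nlinarith
  · nlinarith

/-- Fractional powers of the tempered Mittag-Leffler symbol are Stieltjes transforms of
nonnegative densities. -/
theorem exists_stieltjes_density (ha0 : 0 < a) (ha1 : a < 1) (hc : 0 < c) (hθ : 0 < θ) {p : ℝ}
    (hp0 : 0 < p) (hp1 : p ≤ 1) :
    ∃ ρ : ℝ → ℝ, Continuous ρ ∧ (∀ v, 0 ≤ ρ v) ∧ ∀ w₀ : ℂ, |w₀.im| < Real.pi →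
      Integrable (fun v : ℝ =>
        (ρ v : ℂ) * (Complex.exp v / (Complex.exp v + Complex.exp w₀))) ∧
      ∫ v : ℝ, (ρ v : ℂ) * (Complex.exp v / (Complex.exp v + Complex.exp w₀))
        = tmlSymbol a c θ w₀ ^ (p : ℂ) := by
  have hpi := Real.pi_pos
  set H : ℂ → ℂ := fun w => tmlSymbol a c θ w ^ (p : ℂ) with hH
  set C := (θ + c) / Real.cos (a * Real.pi / 2) * (1 + c⁻¹) with hC
  have hκ := cos_mul_pi_half_pos ha0 ha1
  have hC0 : 0 ≤ C := by positivity
  have hd : ∀ w : ℂ, |w.im| ≤ Real.pi → DifferentiableAt ℂ H w := fun w hw =>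
    (differentiableAt_tmlSymbol ha0 ha1 hc hw).cpow_const
      (tmlSymbol_mem_slitPlane ha0 ha1 hc hθ hw)
  have hpow : ∀ x q : ℝ, ∀ w : ℂ, ‖tmlSymbol a c θ w‖ ≤ C * Real.exp (-q * x) →
      ‖H w‖ ≤ C ^ p * Real.exp (-(q * p) * x) := by
    intro x q w h
    rw [hH]
    simp only
    rw [Complex.norm_cpow_real]
    refine (Real.rpow_le_rpow (norm_nonneg _) h hp0.le).trans (le_of_eq ?_)
    rw [Real.mul_rpow hC0 (Real.exp_pos _).le, ← Real.exp_mul]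
    ring_nf
  have hR : ∀ w : ℂ, |w.im| ≤ Real.pi → 0 ≤ w.re →
      ‖H w‖ ≤ C ^ p * Real.exp (-(a * p) * w.re) := fun w hw hx =>
    hpow _ _ _ (norm_tmlSymbol_le_right ha0 ha1 hc hθ hw hx)
  have hL : ∀ w : ℂ, |w.im| ≤ Real.pi → w.re ≤ 0 →
      ‖H w‖ ≤ C ^ p * Real.exp (-((1 - a) * p) * w.re) := fun w hw hx =>
    hpow _ _ _ (norm_tmlSymbol_le_left ha0 ha1 hc hθ hw hx)
  have hβ : 0 < a * p := by positivity
  have hγ : (1 - a) * p < 1 := by nlinarith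
  have hconj : ∀ w : ℂ, |w.im| ≤ Real.pi → H (starRingEnd ℂ w) = starRingEnd ℂ (H w) := by
    intro w hw
    simp only [hH]
    rw [tmlSymbol_conj, Complex.conj_cpow _ _ (Complex.slitPlane_arg_ne_pi
      (tmlSymbol_mem_slitPlane ha0 ha1 hc hθ hw)), Complex.conj_ofReal]
  have hbd : ∀ x : ℝ, |((x : ℂ) + Real.pi * Complex.I).im| ≤ Real.pi := fun x => by
    simp [abs_of_pos hpi]
  have hjump : ∀ (w₀ : ℂ) (v : ℝ), stripJump H w₀ v
      = (2 * Real.pi * Complex.I) * (((-(H (v + Real.pi * Complex.I)).im / Real.pi : ℝ) : ℂ)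
        * (Complex.exp v / (Complex.exp v + Complex.exp w₀))) := by
    intro w₀ v
    have e1 : (v : ℂ) + (-Real.pi : ℝ) * Complex.I
        = starRingEnd ℂ (v + Real.pi * Complex.I) := by
      simp
    rw [stripJump, e1, hconj _ (hbd v)]
    have hpc : (Real.pi : ℂ) ≠ 0 := by exact_mod_cast hpi.ne'
    have e2 : starRingEnd ℂ (H (v + Real.pi * Complex.I)) - H (v + Real.pi * Complex.I)
        = (2 * Real.pi * Complex.I) * ((-(H (v + Real.pi * Complex.I)).im / Real.pi : ℝ) : ℂ) := by
      apply Complex.ext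
      · simp
      · simp; field_simp; ring
    rw [e2]
    ring
  have hne : (2 * Real.pi * Complex.I : ℂ) ≠ 0 := Complex.two_pi_I_ne_zero
  -- Conjugation symmetry turns the jump into `-2i Im H(v + iπ)`; dividing by the `2πi` of Cauchy's
  -- formula gives this density.
  refine ⟨fun v => -(H (v + Real.pi * Complex.I)).im / Real.pi, ?_, ?_, ?_⟩
  · refine Continuous.div_const (Continuous.neg (Complex.continuous_im.comp ?_)) _
    refine continuous_iff_continuousAt.2 fun x => ?_
    exact ContinuousAt.comp (f := fun v : ℝ => (v : ℂ) + Real.pi * Complex.I)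
      (hd _ (hbd x)).continuousAt (by fun_prop)
  · intro v
    have : (H (v + Real.pi * Complex.I)).im ≤ 0 :=
      Complex.im_cpow_nonpos (tmlSymbol_im_neg ha0 ha1 hc hθ (by simpa using hpi) (by simp)).le
        (tmlSymbol_mem_slitPlane ha0 ha1 hc hθ (hbd v)) hp0.le hp1
    exact div_nonneg (by linarith) hpi.le
  · intro w₀ hw₀
    have hI := integrable_stripJump hd hβ hγ hR hL hw₀
    have hE := integral_stripJump hd hβ hγ hR hL hw₀
    have hf : stripJump H w₀ = fun v : ℝ => (2 * Real.pi * Complex.I) *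
        (((-(H (v + Real.pi * Complex.I)).im / Real.pi : ℝ) : ℂ)
        * (Complex.exp v / (Complex.exp v + Complex.exp w₀))) := funext (hjump w₀)
    rw [hf] at hI hE
    rw [integral_const_mul] at hE
    refine ⟨?_, mul_left_cancel₀ hne hE⟩
    have := hI.const_mul (2 * Real.pi * Complex.I : ℂ)⁻¹
    simpa only [inv_mul_cancel_left₀ hne] using this

end Symbol

/-! ### From Stieltjes densities to mixtures of exponential laws. -/

section ExponentialMixture

theorem integral_exp_neg_mul_Ioi {z : ℂ} (hz : 0 < z.re) :
    ∫ x : ℝ in Ioi 0, Complex.exp (-z * x) = 1 / z := by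
  rw [integral_exp_mul_complex_Ioi (by simpa using hz)]
  simp

/-- A mixture of exponential densities with rates `e ^ v + θ` has the expected Laplace
transform. -/
theorem exists_exponential_mixture {ρ : ℝ → ℝ} {θ : ℝ} (hρ : Continuous ρ)
    (hρ0 : ∀ v, 0 ≤ ρ v) (hθ : 0 < θ)
    (hint : Integrable fun v : ℝ => ρ v * (Real.exp v / (Real.exp v + θ))) :
    ∃ ν : Measure ℝ, IsFiniteMeasure ν ∧ ν (Iio 0) = 0 ∧ ∀ s : ℂ, 0 ≤ s.re →
      ∫ x : ℝ, Complex.exp (-s * x) ∂ν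
        = ∫ v : ℝ, (ρ v : ℂ) * (Complex.exp v / (Complex.exp v + (s + θ))) := by
  set m : Measure (ℝ × ℝ) := volume.prod (volume.restrict (Ioi 0)) with hm
  set g : ℝ × ℝ → ℝ := fun z => ρ z.1 * Real.exp z.1 * Real.exp (-(Real.exp z.1 + θ) * z.2)
    with hg
  have hgc : Continuous g := by fun_prop
  have hg0 : ∀ z, 0 ≤ g z := fun z => by have := hρ0 z.1; positivity
  have hgi : Integrable g m := by
    rw [hm, integrable_prod_iff hgc.aestronglyMeasurable]
    have hneg : ∀ v : ℝ, -(Real.exp v + θ) < 0 := fun v => by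
      have := Real.exp_pos v; linarith
    refine ⟨ae_of_all _ fun v => (integrableOn_exp_mul_Ioi (hneg v) 0).const_mul
      (ρ v * Real.exp v), ?_⟩
    refine hint.congr (ae_of_all _ fun v => ?_)
    simp only [Real.norm_of_nonneg (hg0 _)]
    simp only [hg]
    rw [integral_const_mul, integral_exp_mul_Ioi (hneg v)]
    have := hneg v
    have h2 : Real.exp v + θ ≠ 0 := by linarith
    simp only [mul_zero, Real.exp_zero]
    rw [neg_div_neg_eq]
    field_simp
  set d : ℝ × ℝ → ENNReal := fun z => ENNReal.ofReal (g z) with hd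
  have hdm : Measurable d := hgc.measurable.ennreal_ofReal
  have hdfin : ∀ᵐ z ∂m, d z < ⊤ := ae_of_all _ fun z => ENNReal.ofReal_lt_top
  have hfin : IsFiniteMeasure (m.withDensity d) :=
    isFiniteMeasure_withDensity_ofReal hgi.2
  -- The mixture is the second marginal of the joint density `ρ(v) e ^ v e ^ (-(e ^ v + θ) x)`; its
  -- transform then follows from Fubini.
  refine ⟨(m.withDensity d).map Prod.snd, inferInstance, ?_, ?_⟩
  · rw [Measure.map_apply measurable_snd measurableSet_Iio]
    refine withDensity_absolutelyContinuous m d ?_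
    have : (Prod.snd ⁻¹' Iio 0 : Set (ℝ × ℝ)) = univ ×ˢ Iio 0 := by ext; simp
    rw [this, hm, Measure.prod_prod, Measure.restrict_apply measurableSet_Iio]
    have h2 : Iio (0 : ℝ) ∩ Ioi 0 = ∅ := by
      ext x; simp only [mem_inter_iff, mem_Iio, mem_Ioi, mem_empty_iff_false, iff_false]
      intro h; linarith [h.1, h.2]
    simp [h2]
  · intro s hs
    rw [integral_map measurable_snd.aemeasurable (by fun_prop),
      integral_withDensity_eq_integral_toReal_smul hdm hdfin]
    have hI : Integrable (fun z : ℝ × ℝ => (d z).toReal • Complex.exp (-s * z.2)) m := by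
      refine hgi.mono' ?_ ?_
      · exact (hdm.ennreal_toReal.smul (by fun_prop)).aestronglyMeasurable
      · have hae : ∀ᵐ z ∂m, z ∈ (univ ×ˢ Ioi (0 : ℝ) : Set (ℝ × ℝ)) := by
          have : m = (volume.prod volume).restrict (univ ×ˢ Ioi (0 : ℝ)) := by
            rw [hm, ← Measure.prod_restrict, Measure.restrict_univ]
          rw [this]
          exact ae_restrict_mem (MeasurableSet.univ.prod measurableSet_Ioi)
        filter_upwards [hae] with z hz
        have hz2 : 0 < z.2 := hz.2
        rw [norm_smul, hd, ENNReal.toReal_ofReal (hg0 z), Real.norm_of_nonneg (hg0 z),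
          Complex.norm_exp]
        refine mul_le_of_le_one_right (hg0 z) (Real.exp_le_one_iff.2 ?_)
        simp
        positivity
    rw [hm, integral_prod _ hI]
    congr with v
    have hz : 0 < ((Real.exp v + θ : ℝ) + s : ℂ).re := by
      have := Real.exp_pos v
      simp only [Complex.add_re, Complex.ofReal_re]
      linarith
    have : ∀ x : ℝ, (d (v, x)).toReal • Complex.exp (-s * x)
        = ((ρ v : ℂ) * Complex.exp v) * Complex.exp (-((Real.exp v + θ : ℝ) + s) * x) := by
      intro x
      rw [hd, ENNReal.toReal_ofReal (hg0 _), hg, Complex.real_smul]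
      push_cast
      have e : Complex.exp (-(Complex.exp v + θ + s) * x)
          = Complex.exp (-(Complex.exp v + θ) * x) * Complex.exp (-s * x) := by
        rw [← Complex.exp_add]; ring_nf
      rw [e]
      ring
    simp only [this]
    rw [integral_const_mul, integral_exp_neg_mul_Ioi hz]
    push_cast
    rw [mul_one_div, mul_div_assoc]
    ring_nf

theorem isProbabilityMeasure_of_integral_one {ν : Measure ℝ} [IsFiniteMeasure ν]
    (h : ∫ x : ℝ, Complex.exp (-(0 : ℂ) * x) ∂ν = 1) : IsProbabilityMeasure ν := by
  simp only [neg_zero, zero_mul, Complex.exp_zero, integral_const, Complex.real_smul,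
    mul_one] at h
  have h1 : ν.real univ = 1 := by exact_mod_cast h
  exact ⟨by rwa [Measure.real, ENNReal.toReal_eq_one_iff] at h1⟩

/-- The Laplace transform of the tempered Mittag-Leffler law. -/
def tmlLaplace (a c θ : ℝ) (s : ℂ) : ℂ :=
  ((θ : ℂ) * (s + (θ : ℂ)) ^ ((a : ℂ) - 1) + (c : ℂ)) / ((s + (θ : ℂ)) ^ (a : ℂ) + (c : ℂ))

theorem tmlLaplace_zero {a c θ : ℝ} (hθ : 0 < θ) (h : θ ^ a + c ≠ 0) :
    tmlLaplace a c θ 0 = 1 := by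
  have hθ' : (θ : ℂ) ≠ 0 := by exact_mod_cast hθ.ne'
  have h' : (θ : ℂ) ^ (a : ℂ) + c ≠ 0 := by
    rw [← Complex.ofReal_cpow hθ.le]; exact_mod_cast h
  rw [tmlLaplace, zero_add, Complex.cpow_sub _ _ hθ', Complex.cpow_one, mul_div_cancel₀ _ hθ',
    div_self h']

/-- An `n`-th convolution root of the tempered Mittag-Leffler law, through its Laplace
transform. -/
theorem exists_tml_root_of_lt_one {a c θ : ℝ} (ha0 : 0 < a) (ha1 : a < 1) (hc : 0 < c)
    (hθ : 0 < θ) {n : ℕ} (hn : 1 ≤ n) :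
    ∃ ν : Measure ℝ, IsProbabilityMeasure ν ∧ ν (Iio 0) = 0 ∧ ∀ s : ℂ, 0 ≤ s.re →
      (∫ x : ℝ, Complex.exp (-s * x) ∂ν) ^ n = tmlLaplace a c θ s := by
  have hn0 : (0 : ℝ) < n := by exact_mod_cast hn
  have hn1 : (1 : ℝ) ≤ n := by exact_mod_cast hn
  obtain ⟨ρ, hρc, hρ0, hρ⟩ := exists_stieltjes_density (p := (n : ℝ)⁻¹) ha0 ha1 hc hθ
    (inv_pos.2 hn0) (inv_le_one_of_one_le₀ hn1)
  have hlog : ∀ s : ℂ, 0 ≤ s.re → s + θ ≠ 0 ∧ |(Complex.log (s + θ)).im| < Real.pi := by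
    intro s hs
    have hre : 0 < (s + θ).re := by simp; linarith
    refine ⟨fun h => by simp [h] at hre, ?_⟩
    rw [Complex.log_im]
    have := Complex.abs_arg_lt_pi_div_two_iff.2 (Or.inl hre)
    linarith [Real.pi_pos]
  have hint : Integrable fun v : ℝ => ρ v * (Real.exp v / (Real.exp v + θ)) := by
    have h := (hlog 0 le_rfl)
    have h2 := (hρ _ h.2).1
    rw [Complex.exp_log h.1, zero_add] at h2
    have h3 := h2.re
    refine h3.congr (ae_of_all _ fun v => ?_)
    simp only [RCLike.re_to_complex]
    rw [← Complex.ofReal_re (ρ v * (Real.exp v / (Real.exp v + θ)))]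
    push_cast
    rfl
  obtain ⟨ν, hνf, hν0, hν⟩ := exists_exponential_mixture hρc hρ0 hθ hint
  have hval : ∀ s : ℂ, 0 ≤ s.re →
      ∫ x : ℝ, Complex.exp (-s * x) ∂ν = tmlLaplace a c θ s ^ ((n : ℂ)⁻¹) := by
    intro s hs
    have h := hlog s hs
    have h2 := (hρ _ h.2).2
    rw [Complex.exp_log h.1, tmlSymbol_log h.1] at h2
    rw [hν s hs, h2, tmlLaplace]
    simp
  have hz : ∫ x : ℝ, Complex.exp (-(0 : ℂ) * x) ∂ν = 1 := by
    rw [hval 0 le_rfl, tmlLaplace_zero hθ (by positivity), Complex.one_cpow]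
  refine ⟨ν, isProbabilityMeasure_of_integral_one hz, hν0, fun s hs => ?_⟩
  rw [hval s hs]
  exact Complex.cpow_nat_inv_pow _ (by omega)

end ExponentialMixture

/-! ### The degenerate cases `a = 1` or `c = 0`: gamma laws. -/

section ExponentialCase

theorem integral_cexp_gammaMeasure {p r : ℝ} {s : ℂ} (hp : 0 < p) (hr : 0 < r)
    (hs : 0 ≤ s.re) :
    ∫ x : ℝ, Complex.exp (-s * x) ∂(ProbabilityTheory.gammaMeasure p r)
      = (r : ℂ) ^ (p : ℂ) * (s + r) ^ (-p : ℂ) := by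
  have hG := Real.Gamma_pos_of_pos hp
  have hGc : (Real.Gamma p : ℂ) ≠ 0 := by exact_mod_cast hG.ne'
  have hsr : 0 < (s + r).re := by simp; linarith
  have hm : Measurable (ProbabilityTheory.gammaPDF p r) :=
    (ProbabilityTheory.measurable_gammaPDFReal p r).ennreal_ofReal
  rw [ProbabilityTheory.gammaMeasure, integral_withDensity_eq_integral_toReal_smul hm
    (ae_of_all _ fun x => ENNReal.ofReal_lt_top)]
  have h1 : ∀ x : ℝ, (ProbabilityTheory.gammaPDF p r x).toReal
      = ProbabilityTheory.gammaPDFReal p r x := fun x =>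
    ENNReal.toReal_ofReal (ProbabilityTheory.gammaPDFReal_nonneg hp hr x)
  simp only [h1]
  rw [← setIntegral_eq_integral_of_forall_compl_eq_zero (s := Ici (0 : ℝ)),
    integral_Ici_eq_integral_Ioi]
  · have h2 : ∀ x ∈ Ioi (0 : ℝ), ProbabilityTheory.gammaPDFReal p r x • Complex.exp (-s * x)
        = ((r ^ p / Real.Gamma p : ℝ) : ℂ)
          * (((x ^ (p - 1) : ℝ) : ℂ) * Complex.exp (-(s + r) * x)) := by
      intro x hx
      have e : Complex.exp (-(s + r) * x) = Complex.exp (-(r * x)) * Complex.exp (-s * x) := by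
        rw [← Complex.exp_add]; ring_nf
      rw [ProbabilityTheory.gammaPDFReal, if_pos (le_of_lt hx), Complex.real_smul, e]
      push_cast
      ring
    rw [setIntegral_congr_fun measurableSet_Ioi h2, integral_const_mul,
      integral_rpow_mul_cexp_neg_mul_Ioi hp hsr, Complex.ofReal_div, Complex.ofReal_cpow hr.le]
    field_simp
  · intro x hx
    rw [ProbabilityTheory.gammaPDFReal, if_neg (show ¬0 ≤ x from hx), zero_smul]

theorem gammaMeasure_Iio_zero (p r : ℝ) : ProbabilityTheory.gammaMeasure p r (Iio 0) = 0 := by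
  rw [ProbabilityTheory.gammaMeasure, withDensity_apply _ measurableSet_Iio]
  exact ProbabilityTheory.lintegral_gammaPDF_of_nonpos le_rfl

/-- In both cases the transform collapses to that of an exponential law of rate `θ + c`. These are
exactly the admissible parameters that the strip argument leaves out. -/
theorem tmlLaplace_of_exponential {a c θ : ℝ} (hθ : 0 < θ)
    (h : a = 1 ∨ c = 0) {s : ℂ} (hs : 0 ≤ s.re) :
    tmlLaplace a c θ s = ((θ + c : ℝ) : ℂ) / (s + (θ + c : ℝ)) := by
  have hne : s + θ ≠ 0 := fun h => by
    have := congrArg Complex.re h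
    simp at this; linarith
  rw [tmlLaplace]
  rcases h with rfl | rfl
  · simp [add_assoc]
  · have h2 : (s + θ) ^ (a : ℂ) ≠ 0 := by simp [Complex.cpow_eq_zero_iff, hne]
    rw [Complex.cpow_sub _ _ hne, Complex.cpow_one]
    simp only [Complex.ofReal_zero, add_zero]
    field_simp

theorem exists_tml_root_of_exponential {a c θ : ℝ} (hθ : 0 < θ) (hc : -θ < c)
    (h : a = 1 ∨ c = 0) {n : ℕ} (hn : 1 ≤ n) :
    ∃ ν : Measure ℝ, IsProbabilityMeasure ν ∧ ν (Iio 0) = 0 ∧ ∀ s : ℂ, 0 ≤ s.re →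
      (∫ x : ℝ, Complex.exp (-s * x) ∂ν) ^ n = tmlLaplace a c θ s := by
  have hr : 0 < θ + c := by linarith
  have hn0 : (0 : ℝ) < n := by exact_mod_cast hn
  have hp : 0 < (n : ℝ)⁻¹ := inv_pos.2 hn0
  refine ⟨ProbabilityTheory.gammaMeasure (n : ℝ)⁻¹ (θ + c),
    ProbabilityTheory.isProbabilityMeasure_gammaMeasure hp hr, gammaMeasure_Iio_zero _ _,
    fun s hs => ?_⟩
  rw [integral_cexp_gammaMeasure hp hr hs, tmlLaplace_of_exponential hθ h hs, mul_pow,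
    Complex.cpow_neg, inv_pow]
  push_cast
  rw [Complex.cpow_nat_inv_pow _ (by omega), Complex.cpow_nat_inv_pow _ (by omega)]
  rfl

theorem exists_tml_root {a c θ : ℝ} (ha0 : 0 < a) (ha1 : a ≤ 1) (hθ : 0 < θ)
    (hc : 0 ≤ c ∨ (a = 1 ∧ -θ < c)) {n : ℕ} (hn : 1 ≤ n) :
    ∃ ν : Measure ℝ, IsProbabilityMeasure ν ∧ ν (Iio 0) = 0 ∧ ∀ s : ℂ, 0 ≤ s.re →
      (∫ x : ℝ, Complex.exp (-s * x) ∂ν) ^ n = tmlLaplace a c θ s := by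
  rcases hc with hc | ⟨h1, hc⟩
  · rcases ha1.lt_or_eq with ha | ha
    · rcases hc.lt_or_eq with h | h
      · exact exists_tml_root_of_lt_one ha0 ha h hθ hn
      · exact exists_tml_root_of_exponential hθ (by linarith) (Or.inr h.symm) hn
    · exact exists_tml_root_of_exponential hθ (by linarith) (Or.inl ha) hn
  · exact exists_tml_root_of_exponential hθ hc (Or.inl h1) hn

end ExponentialCase

/-! ### Uniqueness of the Laplace transform on a vertical line. -/

section Uniqueness

theorem integrable_cexp_neg_mul {μ : Measure ℝ} [IsFiniteMeasure μ] (hμ : μ (Iio 0) = 0) {s : ℂ}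
    (hs : 0 ≤ s.re) : Integrable (fun x : ℝ => Complex.exp (-s * x)) μ := by
  refine (integrable_const (1 : ℝ)).mono' (by fun_prop) ?_
  have h : ∀ᵐ x ∂μ, x ∉ Iio (0 : ℝ) := measure_eq_zero_iff_ae_notMem.1 hμ
  filter_upwards [h] with x hx
  have hx0 : 0 ≤ x := not_lt.1 hx
  rw [Complex.norm_exp]
  refine Real.exp_le_one_iff.2 ?_
  simp
  positivity

theorem charFun_withDensity_ofReal {m : Measure ℝ} {g : ℝ → ℝ} (hg : Measurable g) (t : ℝ) :
    charFun (m.withDensity fun x => ENNReal.ofReal (g x)) t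
      = ∫ x, ((max (g x) 0 : ℝ) : ℂ) * Complex.exp (t * x * Complex.I) ∂m := by
  rw [charFun_apply_real, integral_withDensity_eq_integral_toReal_smul hg.ennreal_ofReal
    (ae_of_all _ fun x => ENNReal.ofReal_lt_top)]
  simp only [ENNReal.toReal_ofReal', Complex.real_smul]

/-- A finite law on `[0, ∞)` whose Laplace transform agrees on one vertical line with that of a
function `f` has density `f`, and `f` is nonnegative almost everywhere. -/
theorem eq_withDensity_of_laplace_eq {μ : Measure ℝ} [IsFiniteMeasure μ] (hμ : μ (Iio 0) = 0)
    {f : ℝ → ℝ} (hf : Measurable f) {τ : ℝ} (hτ : 0 ≤ τ)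
    (hint : ∀ s : ℂ, s.re = τ → Integrable fun x : ℝ => (f x : ℂ) * Complex.exp (-s * x))
    (heq : ∀ s : ℂ, s.re = τ →
      ∫ x : ℝ, (f x : ℂ) * Complex.exp (-s * x) = ∫ x : ℝ, Complex.exp (-s * x) ∂μ) :
    (∀ᵐ x : ℝ, 0 ≤ f x) ∧ μ = volume.withDensity fun x => ENNReal.ofReal (f x) := by
  -- Tilting by `e ^ (-τx)` turns equality of transforms on `Re s = τ` into equality of Fourier
  -- transforms.
  set e : ℝ → ℝ := fun x => Real.exp (-τ * x) with he
  have he0 : ∀ x, 0 < e x := fun x => Real.exp_pos _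
  have hem : Measurable e := by fun_prop
  set g : ℝ → ℝ := fun x => f x * e x with hg
  have hgm : Measurable g := hf.mul hem
  have hgi : Integrable g := by
    have h := (hint τ (by simp)).re
    refine h.congr (ae_of_all _ fun x => ?_)
    have : ((f x : ℂ) * Complex.exp (-(τ : ℂ) * x)) = ((g x : ℝ) : ℂ) := by
      rw [hg, he]; push_cast; rfl
    simp only [this]
    simp
  have hei : Integrable e μ := by
    have h := (integrable_cexp_neg_mul hμ (s := τ) (by simpa using hτ)).re
    refine h.congr (ae_of_all _ fun x => ?_)
    have : Complex.exp (-(τ : ℂ) * x) = ((e x : ℝ) : ℂ) := by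
      rw [he]; push_cast; rfl
    simp only [this]
    simp
  set A := (volume : Measure ℝ).withDensity fun x => ENNReal.ofReal (g x) with hA
  set B := (volume : Measure ℝ).withDensity fun x => ENNReal.ofReal (-g x) with hB
  set M := μ.withDensity fun x => ENNReal.ofReal (e x) with hM
  have : IsFiniteMeasure A := isFiniteMeasure_withDensity_ofReal hgi.2
  have : IsFiniteMeasure B := isFiniteMeasure_withDensity_ofReal hgi.neg.2
  have : IsFiniteMeasure M := isFiniteMeasure_withDensity_ofReal hei.2
  -- The sign of `f` is unknown, so the negative part is moved to the other side: both sides are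
  -- then finite positive measures, determined by their characteristic functions.
  have hMB : M + B = A := by
    refine Measure.ext_of_charFun (funext fun t => ?_)
    have hb : ∀ (ν : Measure ℝ) [IsFiniteMeasure ν],
        Integrable (fun x : ℝ => Complex.exp (t * x * Complex.I)) ν := by
      intro ν _
      refine (integrable_const (1 : ℝ)).mono' (by fun_prop) (ae_of_all _ fun x => ?_)
      rw [Complex.norm_exp]
      simp
    have hadd : charFun (M + B) t = charFun M t + charFun B t := by
      simp only [charFun_apply_real]
      exact integral_add_measure (hb M) (hb B)
    have hM' : charFun M t = ∫ x : ℝ, (g x : ℂ) * Complex.exp (t * x * Complex.I) := by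
      rw [hM, charFun_withDensity_ofReal hem]
      have hs : ((τ : ℂ) - t * Complex.I).re = τ := by simp
      have h1 := heq _ hs
      have h2 : ∀ x : ℝ, Complex.exp (-((τ : ℂ) - t * Complex.I) * x)
          = (e x : ℂ) * Complex.exp (t * x * Complex.I) := by
        intro x
        rw [he]
        push_cast
        rw [← Complex.exp_add]
        ring_nf
      simp only [h2] at h1
      simp only [max_eq_left (he0 _).le]
      rw [← h1]
      congr with x
      rw [hg]
      push_cast
      ring
    have hpart : ∀ h : ℝ → ℝ, Integrable h → Integrable fun x : ℝ =>
        ((max (h x) 0 : ℝ) : ℂ) * Complex.exp (t * x * Complex.I) := by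
      intro h hh
      refine hh.pos_part.ofReal.mul_bdd (c := 1) (by fun_prop) (ae_of_all _ fun x => ?_)
      rw [Complex.norm_exp]
      simp
    rw [hadd, hM', hA, hB, charFun_withDensity_ofReal hgm,
      charFun_withDensity_ofReal (g := fun x => -g x) hgm.neg,
      ← eq_sub_iff_add_eq, ← integral_sub (hpart g hgi) (hpart (fun x => -g x) hgi.neg)]
    congr with x
    rw [← sub_mul]
    congr 1
    have : g x = max (g x) 0 - max (-g x) 0 := by
      rcases le_total 0 (g x) with h | h
      · rw [max_eq_left h, max_eq_right (by linarith)]; ring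
      · rw [max_eq_right h, max_eq_left (by linarith)]; ring
    exact_mod_cast this
  -- On `{g < 0}` the measure `A` vanishes, hence so does `B ≤ A`; but `B` has density `-g > 0`
  -- there, so the set is null.
  have hgnonneg : ∀ᵐ x : ℝ, 0 ≤ g x := by
    have hS : MeasurableSet {x | g x < 0} := measurableSet_lt hgm measurable_const
    have hAS : A {x | g x < 0} = 0 := by
      rw [hA, withDensity_apply _ hS, setLIntegral_congr_fun hS
        (fun x hx => ENNReal.ofReal_of_nonpos (le_of_lt hx)), lintegral_zero]
    have hBS : B {x | g x < 0} = 0 := by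
      have : B {x | g x < 0} ≤ A {x | g x < 0} := by
        rw [← hMB]; exact Measure.le_add_left le_rfl _
      exact le_antisymm (this.trans hAS.le) zero_le
    rw [hB, withDensity_apply _ hS, lintegral_eq_zero_iff (by fun_prop),
      Filter.EventuallyEq, ae_restrict_iff' hS] at hBS
    filter_upwards [hBS] with x hx
    by_contra! h
    have := hx h
    simp only [Pi.zero_apply, ENNReal.ofReal_eq_zero] at this
    linarith
  have hB0 : B = 0 := by
    rw [hB, withDensity_eq_zero_iff (by fun_prop)]
    filter_upwards [hgnonneg] with x hx
    exact ENNReal.ofReal_of_nonpos (by linarith)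
  rw [hB0, add_zero] at hMB
  refine ⟨?_, ?_⟩
  · filter_upwards [hgnonneg] with x hx
    exact nonneg_of_mul_nonneg_left hx (he0 x)
  · have hi : Measurable fun x : ℝ => ENNReal.ofReal (e x)⁻¹ := by fun_prop
    have h1 : M.withDensity (fun x => ENNReal.ofReal (e x)⁻¹) = μ := by
      rw [hM, ← withDensity_mul _ hem.ennreal_ofReal hi]
      have : ((fun x => ENNReal.ofReal (e x)) * fun x => ENNReal.ofReal (e x)⁻¹) = 1 := by
        ext x
        simp only [Pi.mul_apply, Pi.one_apply]
        rw [← ENNReal.ofReal_mul (he0 x).le, mul_inv_cancel₀ (he0 x).ne', ENNReal.ofReal_one]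
      rw [this, withDensity_one]
    rw [← h1, hMB, hA, ← withDensity_mul _ hgm.ennreal_ofReal hi]
    congr with x
    simp only [Pi.mul_apply]
    rw [← ENNReal.ofReal_mul' (inv_nonneg.2 (he0 x).le), hg, mul_inv_cancel_right₀ (he0 x).ne']

end Uniqueness

/-! ### Density, distribution function and infinite divisibility. -/

section TemperedMittagLeffler

variable {a c θ : ℝ}

theorem measurable_tmlPDF (ha : 0 < a) : Measurable (tmlPDF a c θ) := by
  have h1 : Measurable (mittagLeffler a) := (continuous_mittagLeffler₂ ha one_pos).measurable
  have h2 : Measurable (mittagLeffler₂ a a) := (continuous_mittagLeffler₂ ha ha).measurable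
  have h3 : Measurable fun x : ℝ => -c * x ^ a := by fun_prop
  refine Measurable.ite measurableSet_Ici ?_ measurable_const
  exact Measurable.mul (by fun_prop) (((h1.comp h3).const_mul θ).add
    (Measurable.mul (by fun_prop) (h2.comp h3)))

theorem tmlPDF_of_pos {x : ℝ} (hx : 0 < x) : tmlPDF a c θ x =
    θ * Real.exp (-θ * x) * (x ^ ((1 : ℝ) - 1) * mittagLeffler₂ a 1 (-c * x ^ a))
      + c * Real.exp (-θ * x) * (x ^ (a - 1) * mittagLeffler₂ a a (-c * x ^ a)) := by
  rw [tmlPDF, if_pos hx.le, mittagLeffler, sub_self, Real.rpow_zero]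
  ring

theorem tmlPDF_of_neg {x : ℝ} (hx : x < 0) : tmlPDF a c θ x = 0 := if_neg (not_le.2 hx)

theorem continuousOn_tmlPDF (ha : 0 < a) : ContinuousOn (tmlPDF a c θ) (Ioi 0) := by
  refine ContinuousOn.congr ?_ fun x hx => tmlPDF_of_pos hx
  exact (ContinuousOn.mul (by fun_prop) (continuousOn_rpow_mul_mittagLeffler₂ ha one_pos c _)).add
    (ContinuousOn.mul (by fun_prop) (continuousOn_rpow_mul_mittagLeffler₂ ha ha c _))

/-- The factor `e ^ (-θx)` shifts `s` to `z = s + θ`; the cases `b = 1` and `b = a` add up to `(θ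
z⁻¹ + c z ^ (-a)) / (1 + c z ^ (-a))`. -/
theorem laplace_tmlPDF (ha : 0 < a) {s : ℂ} (hs : 0 < (s + θ).re) (hc : |c| < (s + θ).re ^ a) :
    Integrable (fun x : ℝ => (tmlPDF a c θ x : ℂ) * Complex.exp (-s * x)) ∧
    ∫ x : ℝ, (tmlPDF a c θ x : ℂ) * Complex.exp (-s * x) = tmlLaplace a c θ s := by
  set z := s + θ with hz
  have hz0 : z ≠ 0 := fun h => by simp [h] at hs
  obtain ⟨i1, e1⟩ := laplace_mittagLeffler₂ ha one_pos hs hc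
  obtain ⟨i2, e2⟩ := laplace_mittagLeffler₂ ha ha hs hc
  have hsupp : ∀ x : ℝ, x ∉ Ici (0 : ℝ) → (tmlPDF a c θ x : ℂ) * Complex.exp (-s * x) = 0 := by
    intro x hx
    rw [tmlPDF_of_neg (not_le.1 hx)]
    simp
  have hEq : ∀ x ∈ Ioi (0 : ℝ), (tmlPDF a c θ x : ℂ) * Complex.exp (-s * x)
      = θ * (((x ^ ((1 : ℝ) - 1) * mittagLeffler₂ a 1 (-c * x ^ a) : ℝ) : ℂ)
          * Complex.exp (-z * x))
        + c * (((x ^ (a - 1) * mittagLeffler₂ a a (-c * x ^ a) : ℝ) : ℂ)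
          * Complex.exp (-z * x)) := by
    intro x hx
    rw [tmlPDF_of_pos hx]
    have e : Complex.exp (-z * x) = Complex.exp (-θ * x) * Complex.exp (-s * x) := by
      rw [hz, ← Complex.exp_add]; ring_nf
    rw [e]
    push_cast
    ring
  have hden : 1 + (c : ℂ) * z ^ (-a : ℂ) ≠ 0 := by
    intro h
    have h1 : ‖(c : ℂ) * z ^ (-a : ℂ)‖ = 1 := by
      rw [eq_neg_of_add_eq_zero_right h]; simp
    have h2 : ‖z ^ (-a : ℂ)‖ = ‖z‖ ^ (-a) := by
      have := Complex.norm_cpow_real z (-a)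
      simpa using this
    rw [norm_mul, h2, Complex.norm_real, Real.norm_eq_abs] at h1
    have h3 : z.re ^ a ≤ ‖z‖ ^ a := Real.rpow_le_rpow hs.le (Complex.re_le_norm z) ha.le
    have h4 : 0 < ‖z‖ := norm_pos_iff.2 hz0
    have h5 : |c| * ‖z‖ ^ (-a) < ‖z‖ ^ a * ‖z‖ ^ (-a) := by
      gcongr; exact hc.trans_le h3
    rw [h1, ← Real.rpow_add h4] at h5
    simp at h5
  have hza : z ^ (a : ℂ) ≠ 0 := by simp [Complex.cpow_eq_zero_iff, hz0]
  constructor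
  · rw [← integrableOn_iff_integrable_of_support_subset (s := Ici (0 : ℝ)),
      integrableOn_Ici_iff_integrableOn_Ioi]
    · exact IntegrableOn.congr_fun ((i1.const_mul (θ : ℂ)).add (i2.const_mul (c : ℂ)))
        (fun x hx => (hEq x hx).symm) measurableSet_Ioi
    · intro x hx
      by_contra h
      exact hx (hsupp x h)
  · rw [← setIntegral_eq_integral_of_forall_compl_eq_zero hsupp, integral_Ici_eq_integral_Ioi,
      setIntegral_congr_fun measurableSet_Ioi hEq,
      integral_add (i1.const_mul (θ : ℂ)) (i2.const_mul (c : ℂ)), integral_const_mul,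
      integral_const_mul, e1, e2, tmlLaplace, ← hz, Complex.cpow_neg, Complex.cpow_neg,
      Complex.cpow_sub _ _ hz0]
    rw [Complex.cpow_neg] at hden
    have hden' : z ^ (a : ℂ) + c ≠ 0 := by
      intro h
      apply hden
      field_simp
      simpa using h
    simp only [Complex.ofReal_one, Complex.cpow_one]
    field_simp

/-- The point `0` is handled by convention: `0 ^ (a - 1)` is `0` for `a < 1` and `1` for `a = 1`, so
the value is `θ` or `θ + c`. -/
theorem tmlPDF_zero_nonneg (ha0 : 0 < a) (hθ : 0 < θ) (hc : 0 ≤ c ∨ (a = 1 ∧ -θ < c)) :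
    0 ≤ tmlPDF a c θ 0 := by
  have h2 : mittagLeffler₂ a a 0 = 1 / Real.Gamma a := by
    rw [mittagLeffler₂, tsum_eq_single 0]
    · simp
    · intro k hk; simp [hk]
  have hG := Real.Gamma_pos_of_pos ha0
  rw [tmlPDF, if_pos le_rfl, Real.zero_rpow ha0.ne', mul_zero, mul_zero, Real.exp_zero,
    mittagLeffler_zero, h2]
  rcases hc with hc | ⟨rfl, hc⟩
  · have := Real.rpow_nonneg le_rfl (a - 1) (x := (0 : ℝ))
    positivity
  · simp
    linarith

/-- By continuity on `(0, ∞)`, a negative value there would persist on a nonempty open set, which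
has positive measure. -/
theorem tmlPDF_nonneg_of_ae (ha0 : 0 < a) (hθ : 0 < θ) (hc : 0 ≤ c ∨ (a = 1 ∧ -θ < c))
    (h : ∀ᵐ x : ℝ, 0 ≤ tmlPDF a c θ x) (x : ℝ) : 0 ≤ tmlPDF a c θ x := by
  rcases lt_trichotomy x 0 with hx | rfl | hx
  · rw [tmlPDF_of_neg hx]
  · exact tmlPDF_zero_nonneg ha0 hθ hc
  · by_contra! hneg
    have hopen : IsOpen (Ioi 0 ∩ tmlPDF a c θ ⁻¹' Iio 0) :=
      (continuousOn_tmlPDF ha0).isOpen_inter_preimage isOpen_Ioi isOpen_Iio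
    have hpos := hopen.measure_pos volume ⟨x, hx, hneg⟩
    have h0 : volume {x : ℝ | ¬0 ≤ tmlPDF a c θ x} = 0 := h
    refine hpos.ne' (measure_mono_null (fun y hy => ?_) h0)
    exact not_le.2 hy.2

theorem hasDerivAt_tmlCDF (ha : 0 < a) {x : ℝ} (hx : 0 < x) :
    HasDerivAt (fun x : ℝ => 1 - Real.exp (-θ * x) * mittagLeffler a (-c * x ^ a))
      (tmlPDF a c θ x) x := by
  have h1 : HasDerivAt (fun x : ℝ => -c * x ^ a) (-c * (a * x ^ (a - 1))) x :=
    (Real.hasDerivAt_rpow_const (Or.inl hx.ne')).const_mul _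
  have h2 := (hasDerivAt_mittagLeffler ha (-c * x ^ a)).comp x h1
  have h3 : HasDerivAt (fun x : ℝ => Real.exp (-θ * x)) (Real.exp (-θ * x) * (-θ * 1)) x :=
    ((hasDerivAt_id x).const_mul (-θ)).exp
  refine ((h3.mul h2).const_sub 1).congr_deriv ?_
  rw [tmlPDF, if_pos hx.le]
  simp only [Function.comp_apply]
  field_simp
  ring

theorem continuous_tmlCDF_formula (ha : 0 < a) :
    Continuous fun x : ℝ => 1 - Real.exp (-θ * x) * mittagLeffler a (-c * x ^ a) := by
  have h1 : Continuous (mittagLeffler a) := continuous_mittagLeffler₂ ha one_pos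
  have h2 : Continuous fun x : ℝ => x ^ a := Real.continuous_rpow_const ha.le
  exact continuous_const.sub (Continuous.mul (by fun_prop) (h1.comp (continuous_const.mul h2)))

theorem cdf_eq_tmlCDF (ha : 0 < a) {μ : Measure ℝ} [IsProbabilityMeasure μ]
    (hμ0 : μ (Iio 0) = 0) (hf0 : ∀ x, 0 ≤ tmlPDF a c θ x)
    (hμ : μ = volume.withDensity fun x => ENNReal.ofReal (tmlPDF a c θ x)) (x : ℝ) :
    ProbabilityTheory.cdf μ x = tmlCDF a c θ x := by
  have hm : Measurable (tmlPDF a c θ) := measurable_tmlPDF ha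
  have hfi : Integrable (tmlPDF a c θ) := by
    refine ⟨hm.aestronglyMeasurable, ?_⟩
    rw [hasFiniteIntegral_iff_ofReal (ae_of_all _ hf0)]
    have h1 : μ univ = 1 := measure_univ
    rw [hμ, withDensity_apply _ MeasurableSet.univ, Measure.restrict_univ] at h1
    rw [h1]
    exact ENNReal.one_lt_top
  rw [ProbabilityTheory.cdf_eq_real, tmlCDF]
  split_ifs with hx
  · have h1 : μ.real (Iic x) = ∫ y in Iic x, tmlPDF a c θ y := by
      rw [hμ, Measure.real, withDensity_apply _ measurableSet_Iic,
        ← ofReal_integral_eq_lintegral_ofReal hfi.integrableOn (ae_of_all _ hf0),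
        ENNReal.toReal_ofReal (integral_nonneg hf0)]
    have h2 : ∫ y in Iic (0 : ℝ), tmlPDF a c θ y = 0 := by
      rw [integral_Iic_eq_integral_Iio, setIntegral_congr_fun measurableSet_Iio
        (fun y hy => tmlPDF_of_neg hy), integral_zero]
    have h3 := intervalIntegral.integral_Iic_sub_Iic (hfi.integrableOn (s := Iic 0))
      (hfi.integrableOn (s := Iic x))
    -- The density may blow up at `0`, so this version asks only for continuity of `F` on `[0, x]`
    -- and a derivative inside; integrability comes from total mass one.
    rw [h2, sub_zero, intervalIntegral.integral_eq_sub_of_hasDerivAt_of_le hx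
      (continuous_tmlCDF_formula ha).continuousOn (fun y hy => hasDerivAt_tmlCDF ha hy.1)
      hfi.intervalIntegrable] at h3
    rw [h1, h3, Real.zero_rpow ha.ne', mul_zero, mul_zero, mittagLeffler_zero]
    simp
  · rw [Measure.real, measure_mono_null (fun y hy => ?_) hμ0, ENNReal.toReal_zero]
    exact lt_of_le_of_lt hy (not_le.1 hx)

theorem isInfinitelyDivisible_of_tmlLaplace (ha0 : 0 < a) (ha1 : a ≤ 1) (hθ : 0 < θ)
    (hc : 0 ≤ c ∨ (a = 1 ∧ -θ < c)) {μ : Measure ℝ} [IsProbabilityMeasure μ]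
    (hμ : ∀ s : ℂ, 0 ≤ s.re → ∫ x : ℝ, Complex.exp (-s * x) ∂μ = tmlLaplace a c θ s) :
    IsInfinitelyDivisible μ := by
  intro n hn
  obtain ⟨ν, hν, -, hlap⟩ := exists_tml_root ha0 ha1 hθ hc hn
  refine ⟨ν, hν, ?_⟩
  have : IsProbabilityMeasure
      ((Measure.pi fun _ : Fin n => ν).map (fun x : Fin n → ℝ => ∑ i, x i)) :=
    Measure.isProbabilityMeasure_map (by fun_prop)
  refine Measure.ext_of_charFun ?_
  rw [ProbabilityTheory.charFun_map_sum_pi_eq_prod]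
  ext t
  have h : ∀ m : Measure ℝ, charFun m t
      = ∫ x : ℝ, Complex.exp (-(-(t * Complex.I)) * x) ∂m := by
    intro m
    rw [charFun_apply_real]
    congr with x
    ring_nf
  -- Characteristic functions are transforms on the imaginary axis, which is why the transform
  -- identities include `Re s = 0`.
  have hs : 0 ≤ (-(t * Complex.I) : ℂ).re := by simp
  simp only [Finset.prod_const, Finset.card_univ, Fintype.card_fin, Pi.pow_apply]
  rw [h, h, hlap _ hs, hμ _ hs]

end TemperedMittagLeffler

end

theorem proposition4p1 (a c θ : ℝ) (ha0 : 0 < a) (ha1 : a ≤ 1) (hθ : 0 < θ)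
    (hc : 0 ≤ c ∨ (a = 1 ∧ -θ < c)) :
    ∃ μ : Measure ℝ, IsProbabilityMeasure μ ∧ μ (Set.Iio 0) = 0 ∧
      (∀ x : ℝ, ProbabilityTheory.cdf μ x = tmlCDF a c θ x) ∧
      (Measurable (tmlPDF a c θ) ∧ (∀ x : ℝ, 0 ≤ tmlPDF a c θ x) ∧
        μ = volume.withDensity (fun x : ℝ => ENNReal.ofReal (tmlPDF a c θ x))) ∧
      (∀ s : ℂ, 0 < s.re →
        Integrable (fun x : ℝ => Complex.exp (-s * (x : ℂ))) μ ∧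
        ∫ x : ℝ, Complex.exp (-s * (x : ℂ)) ∂μ =
          ((θ : ℂ) * (s + (θ : ℂ)) ^ ((a : ℂ) - 1) + (c : ℂ)) /
            ((s + (θ : ℂ)) ^ (a : ℂ) + (c : ℂ))) ∧
      IsInfinitelyDivisible μ := by
  -- The law itself is its own first convolution root, `n = 1`.
  obtain ⟨μ, hμp, hμ0, hlap⟩ := exists_tml_root ha0 ha1 hθ hc le_rfl
  simp only [pow_one] at hlap
  -- Gives `τ ^ a = |c| + 1 > |c|`, so the line `Re s = τ` lies where the transform of `f` may be
  -- computed from the series.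
  set τ : ℝ := (|c| + 1) ^ (1 / a) with hτ
  have hτ0 : 0 ≤ τ := by positivity
  have hτc : |c| < (τ + θ) ^ a := by
    have h1 : τ ^ a = |c| + 1 := by
      rw [hτ, ← Real.rpow_mul (by positivity), one_div_mul_cancel ha0.ne', Real.rpow_one]
    have h2 : τ ^ a ≤ (τ + θ) ^ a := Real.rpow_le_rpow hτ0 (by linarith) ha0.le
    linarith
  have hpdf : ∀ s : ℂ, s.re = τ →
      Integrable (fun x : ℝ => (tmlPDF a c θ x : ℂ) * Complex.exp (-s * x)) ∧
      ∫ x : ℝ, (tmlPDF a c θ x : ℂ) * Complex.exp (-s * x) = tmlLaplace a c θ s := by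
    intro s hs
    have hre : (s + θ).re = τ + θ := by simp [hs]
    exact laplace_tmlPDF ha0 (by rw [hre]; linarith) (by rwa [hre])
  obtain ⟨hae, hden⟩ := eq_withDensity_of_laplace_eq hμ0 (measurable_tmlPDF ha0) hτ0
    (fun s hs => (hpdf s hs).1)
    (fun s hs => (hpdf s hs).2.trans (hlap s (by rw [hs]; exact hτ0)).symm)
  have hnn := tmlPDF_nonneg_of_ae ha0 hθ hc hae
  exact ⟨μ, hμp, hμ0, cdf_eq_tmlCDF ha0 hμ0 hnn hden,
    ⟨measurable_tmlPDF ha0, hnn, hden⟩,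
    fun s hs => ⟨integrable_cexp_neg_mul hμ0 hs.le, hlap s hs.le⟩,
    isInfinitelyDivisible_of_tmlLaplace ha0 ha1 hθ hc hlap⟩
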